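/- Let $\mathbb{H}$ be the quaternions, $\mathbb{B}\subset\mathbb{H}$ the open unit ball, $\mathrm{Sp}(1)=\{u\in\mathbb{H}: |u|=1\}$ and $\mathrm{Sp}(1,1)=\{A\in M_2(\mathbb{H}): A^*I_{1,1}A=I_{1,1}\}$ with $I_{1,1}=\mathrm{diag}(1,-1)$, a Lie group and an embedded submanifold of $M_2(\mathbb{H})\cong\mathbb{R}^{16}$. For functions on $\mathbb{B}$ given by convergent power series with right coefficients, $f(q)=\sum_n q^na_n$ and $g(q)=\sum_n q^nb_n$, put $(f*g)(q)=\sum_n q^n\sum_{k=0}^n a_kb_{n-k}$, $f^c(q)=\sum_n q^n\overline{a}_n$, $f^s=f*f^c$ and $f^{-*}=(f^s)^{-1}f^c$ (off the zeros of $f^s$). For $A=\begin{pmatrix}a&c\\ b&d\end{pmatrix}\in\mathrm{Sp}(1,1)$ let $\mathcal{F}_A:\mathbb{B}\to\mathbb{B}$, $\mathcal{F}_A(q)=(qc+d)^{-*}*(qa+b)$, be the slice regular Möbius transformation of $A$, and let $\mathcal{M}(\mathbb{B})=\{\mathcal{F}_A: A\in\mathrm{Sp}(1,1)\}$. The set $\mathcal{M}(\mathbb{B})\cong\mathrm{Sp}(1,1)/\mathrm{Sp}(1)I_2$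 admits a (Hausdorff, second countable) smooth manifold structure of dimension $7$ with the quotient topology for which the map $\mathrm{Sp}(1,1)\to\mathcal{M}(\mathbb{B})$, $A\mapsto\mathcal{F}_{A^{-1}}$, is a submersion, i.e. smooth and surjective with surjective differential at every point. For this manifold structure the evaluation map $$\mathcal{M}(\mathbb{B})\times\mathbb{B}\to\mathbb{B},\qquad(\mathcal{F},q)\mapsto\mathcal{F}(q),$$ is smooth, and the following hold. 1. (Transitivity) For every $p,q\in\mathbb{B}$ there is $\mathcal{F}\in\mathcal{M}(\mathbb{B})$ with $\mathcal{F}(p)=q$. 2. (Isotropy at $0$) $\mathcal{M}(\mathbb{B})_0:=\{\mathcal{F}\in\mathcal{M}(\mathbb{B}):\mathcal{F}(0)=0\}=\{R_u:u\in\mathrm{Sp}(1)\}$, where $R_u(q)=qu$ for $q\in\mathbb{B}$. 3. (Structure of the isotropy) $\mathcal{M}(\mathbb{B})_0$ is a compact (embedded, $3$-dimensional) submanifold of $\mathcal{M}(\mathbb{B})$, and with this manifold structure and the composition of maps it is a Lie group. The map $\rho:\mathrm{Sp}(1)\to\mathcal{M}(\mathbb{B})_0$, $u\mapsto R_{u^{-1}}$,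 is an isomorphism of Lie groups (a group isomorphism that is smooth with smooth inverse). -/

import Mathlib

open scoped Manifold ContDiff Quaternion Matrix

noncomputable section

namespace RegMobius

/-! ### The unit ball, the unit quaternions and the group `Sp(1,1)` -/

/-- The open unit ball `𝔹` of the quaternions, an open submanifold of `ℍ`. -/
abbrev Ball : TopologicalSpace.Opens ℍ := ⟨Metric.ball 0 1, Metric.isOpen_ball⟩

theorem norm_lt_one (q : Ball) : ‖(q : ℍ)‖ < 1 :=
  mem_ball_zero_iff.1 q.2

instance : Zero Ball := ⟨⟨0, Metric.mem_ball_self one_pos⟩⟩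

/-- `Sp(1)`, the unit sphere of `ℍ`, with Mathlib's group structure (quaternion multiplication)
and Mathlib's manifold structure of the sphere. -/
abbrev Sp1 : Type := Metric.sphere (0 : ℍ) 1

instance : Fact (Module.finrank ℝ ℍ = 3 + 1) := ⟨Quaternion.finrank_eq_four⟩

theorem norm_Sp1 (u : Sp1) : ‖(u : ℍ)‖ = 1 := by simp

/-- The matrix `I_{1,1} = diag(1, -1)`. -/
def J : Matrix (Fin 2) (Fin 2) ℍ := !![1, 0; 0, -1]

theorem J_mul_J : J * J = 1 := by
  refine Matrix.ext fun i j => ?_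
  fin_cases i <;> fin_cases j <;> simp [J, Matrix.mul_apply, Fin.sum_univ_two]

theorem J_conjTranspose : Jᴴ = J := by
  refine Matrix.ext fun i j => ?_
  fin_cases i <;> fin_cases j <;> simp [J, Matrix.conjTranspose_apply]

/-- `Sp(1,1) = {A ∈ M₂(ℍ) : A* I_{1,1} A = I_{1,1}}`, with the topology of a subspace of the
matrices. -/
def Sp11 : Submonoid (Matrix (Fin 2) (Fin 2) ℍ) where
  carrier := {A | Aᴴ * J * A = J}
  one_mem' := by simp
  mul_mem' := by
    intro A B hA hB
    simp only [Set.mem_ofPred_eq] at *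
    calc (A * B)ᴴ * J * (A * B) = Bᴴ * (Aᴴ * J * A) * B := by
          simp only [Matrix.conjTranspose_mul, Matrix.mul_assoc]
      _ = J := by rw [hA, hB]

namespace Sp11

theorem mem_iff {A : Matrix (Fin 2) (Fin 2) ℍ} : A ∈ Sp11 ↔ Aᴴ * J * A = J := Iff.rfl

theorem inv_mul_aux (A : Sp11) : (J * (A : Matrix (Fin 2) (Fin 2) ℍ)ᴴ * J) * A = 1 := by
  have h : (A : Matrix (Fin 2) (Fin 2) ℍ)ᴴ * J * A = J := A.2
  rw [Matrix.mul_assoc J, Matrix.mul_assoc J, h, J_mul_J]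

theorem mul_inv_aux (A : Sp11) :
    (A : Matrix (Fin 2) (Fin 2) ℍ) * (J * (A : Matrix (Fin 2) (Fin 2) ℍ)ᴴ * J) = 1 :=
  mul_eq_one_symm (inv_mul_aux A)

theorem mul_J_mul (A : Sp11) :
    (A : Matrix (Fin 2) (Fin 2) ℍ) * J * (A : Matrix (Fin 2) (Fin 2) ℍ)ᴴ = J := by
  have h := congrArg (· * J) (mul_inv_aux A)
  simpa [Matrix.mul_assoc, J_mul_J] using h

theorem inv_mem (A : Sp11) : J * (A : Matrix (Fin 2) (Fin 2) ℍ)ᴴ * J ∈ Sp11 := by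
  rw [mem_iff]
  simp only [Matrix.conjTranspose_mul, Matrix.conjTranspose_conjTranspose, J_conjTranspose]
  calc J * ((A : Matrix (Fin 2) (Fin 2) ℍ) * J) * J * (J * (A : Matrix (Fin 2) (Fin 2) ℍ)ᴴ * J)
      = J * ((A : Matrix (Fin 2) (Fin 2) ℍ) * J * (J * J) * (A : Matrix (Fin 2) (Fin 2) ℍ)ᴴ) * J := by
        simp only [Matrix.mul_assoc]
    _ = J := by rw [J_mul_J, Matrix.mul_one, mul_J_mul, J_mul_J, Matrix.one_mul]

/-- `Sp(1,1)` is a group under matrix multiplication, with `A⁻¹ = I_{1,1} A* I_{1,1}`. -/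
instance : Group Sp11 where
  inv A := ⟨J * (A : Matrix (Fin 2) (Fin 2) ℍ)ᴴ * J, inv_mem A⟩
  inv_mul_cancel A := Subtype.ext (inv_mul_aux A)

theorem coe_inv (A : Sp11) :
    ((A⁻¹ : Sp11) : Matrix (Fin 2) (Fin 2) ℍ) = J * (A : Matrix (Fin 2) (Fin 2) ℍ)ᴴ * J := rfl

theorem mem_iff_entries {A : Matrix (Fin 2) (Fin 2) ℍ} : A ∈ Sp11 ↔
    star (A 0 0) * A 0 0 - star (A 1 0) * A 1 0 = 1 ∧
    star (A 0 0) * A 0 1 - star (A 1 0) * A 1 1 = 0 ∧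
    star (A 0 1) * A 0 0 - star (A 1 1) * A 1 0 = 0 ∧
    star (A 0 1) * A 0 1 - star (A 1 1) * A 1 1 = -1 := by
  rw [mem_iff, ← Matrix.ext_iff]
  simp [Fin.forall_fin_two, J, Matrix.mul_apply, Fin.sum_univ_two, Matrix.conjTranspose_apply,
    sub_eq_add_neg, and_assoc]

theorem row_entries (A : Sp11) :
    A.1 0 0 * star (A.1 0 0) - A.1 0 1 * star (A.1 0 1) = 1 ∧
    A.1 0 0 * star (A.1 1 0) - A.1 0 1 * star (A.1 1 1) = 0 ∧
    A.1 1 0 * star (A.1 0 0) - A.1 1 1 * star (A.1 0 1) = 0 ∧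
    A.1 1 0 * star (A.1 1 0) - A.1 1 1 * star (A.1 1 1) = -1 := by
  have h := mul_J_mul A
  rw [← Matrix.ext_iff] at h
  simpa [Fin.forall_fin_two, J, Matrix.mul_apply, Fin.sum_univ_two, Matrix.conjTranspose_apply,
    sub_eq_add_neg, and_assoc] using h

theorem star_mul_self_eq (x : ℍ) : star x * x = ((‖x‖ ^ 2 : ℝ) : ℍ) := by
  rw [Quaternion.star_mul_self, Quaternion.normSq_eq_norm_mul_self, sq]

theorem self_mul_star_eq (x : ℍ) : x * star x = ((‖x‖ ^ 2 : ℝ) : ℍ) := by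
  rw [Quaternion.self_mul_star, Quaternion.normSq_eq_norm_mul_self, sq]

theorem norm_sq_col (A : Sp11) : ‖A.1 0 0‖ ^ 2 - ‖A.1 1 0‖ ^ 2 = 1 := by
  have h := (mem_iff_entries.1 A.2).1
  rw [star_mul_self_eq, star_mul_self_eq] at h
  refine Quaternion.coe_injective ?_
  push_cast at h ⊢
  exact h

theorem norm_sq_row₀ (A : Sp11) : ‖A.1 0 0‖ ^ 2 - ‖A.1 0 1‖ ^ 2 = 1 := by
  have h := (row_entries A).1
  rw [self_mul_star_eq, self_mul_star_eq] at h
  refine Quaternion.coe_injective ?_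
  push_cast at h ⊢
  exact h

theorem norm_sq_row₁ (A : Sp11) : ‖A.1 1 0‖ ^ 2 - ‖A.1 1 1‖ ^ 2 = -1 := by
  have h := (row_entries A).2.2.2
  rw [self_mul_star_eq, self_mul_star_eq] at h
  refine Quaternion.coe_injective ?_
  push_cast at h ⊢
  exact h

theorem norm_01_lt (A : Sp11) : ‖A.1 0 1‖ < ‖A.1 1 1‖ := by
  have h1 := norm_sq_col A
  have h2 := norm_sq_row₀ A
  have h3 := norm_sq_row₁ A
  refine lt_of_pow_lt_pow_left₀ 2 (norm_nonneg _) ?_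
  linarith

end Sp11

/-! ### The manifold structure of `Sp(1,1)`

`Sp(1,1)` is a closed embedded submanifold of the space of matrices.  It has a global
parametrization by `ℍ × S³ × S³`, namely
`(b, u, v) ↦ (s u, u b̄ v; b, s v)` with `s = √(1 + |b|²)`, whose inverse is
`A ↦ (b, a/|a|, d/|d|)`.  The charts of `Sp(1,1)` are obtained from it; `Sp11.contMDiff_iff` checks
that this is the structure of an embedded submanifold of the matrices. -/

namespace Sp11

theorem norm_row_eq (A : Sp11) :
    ‖A.1 0 0‖ = √(1 + ‖A.1 1 0‖ ^ 2) ∧ ‖A.1 1 1‖ = √(1 + ‖A.1 1 0‖ ^ 2) := by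
  have h1 := norm_sq_col A
  have h3 := norm_sq_row₁ A
  constructor <;> (symm; rw [Real.sqrt_eq_iff_eq_sq (by positivity) (norm_nonneg _)]; linarith)

theorem norm_pos (A : Sp11) : 0 < ‖A.1 0 0‖ ∧ 0 < ‖A.1 1 1‖ := by
  rw [(norm_row_eq A).1, (norm_row_eq A).2]
  exact ⟨Real.sqrt_pos.2 (by positivity), Real.sqrt_pos.2 (by positivity)⟩

/-- The matrix with coordinates `(b, u, v)`. -/
def paramMatrix (x : ℍ × ℍ × ℍ) : Matrix (Fin 2) (Fin 2) ℍ :=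
  !![√(1 + ‖x.1‖ ^ 2) • x.2.1, x.2.1 * star x.1 * x.2.2; x.1, √(1 + ‖x.1‖ ^ 2) • x.2.2]

theorem paramMatrix_mem (b : ℍ) (u v : Sp1) : paramMatrix (b, u, v) ∈ Sp11 := by
  have hs : √(1 + ‖b‖ ^ 2) ^ 2 = 1 + ‖b‖ ^ 2 := Real.sq_sqrt (by positivity)
  have hu : star (u : ℍ) * u = 1 := by rw [star_mul_self_eq]; simp
  have hv : star (v : ℍ) * v = 1 := by rw [star_mul_self_eq]; simp
  have h1 : star (√(1 + ‖b‖ ^ 2) • (u : ℍ)) * (u * star b * v)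
      = star b * √(1 + ‖b‖ ^ 2) • (v : ℍ) := by
    rw [Quaternion.star_smul, smul_mul_assoc, mul_smul_comm, mul_assoc, ← mul_assoc (star (u : ℍ)),
      hu, one_mul]
  rw [mem_iff_entries]
  refine ⟨?_, ?_, ?_, ?_⟩
  · simp only [paramMatrix, Matrix.of_apply, Matrix.cons_val', Matrix.cons_val_zero,
      Matrix.cons_val_one, Matrix.cons_val_fin_one]
    rw [star_mul_self_eq, star_mul_self_eq, norm_smul, mul_pow, Real.norm_eq_abs, sq_abs, hs]
    simp
  · simp only [paramMatrix, Matrix.of_apply, Matrix.cons_val', Matrix.cons_val_zero,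
      Matrix.cons_val_one, Matrix.cons_val_fin_one]
    rw [h1, sub_self]
  · simp only [paramMatrix, Matrix.of_apply, Matrix.cons_val', Matrix.cons_val_zero,
      Matrix.cons_val_one, Matrix.cons_val_fin_one]
    rw [sub_eq_zero]
    simpa using congrArg star h1
  · simp only [paramMatrix, Matrix.of_apply, Matrix.cons_val', Matrix.cons_val_zero,
      Matrix.cons_val_one, Matrix.cons_val_fin_one]
    rw [star_mul_self_eq, star_mul_self_eq, norm_smul, mul_pow, Real.norm_eq_abs, sq_abs, hs]
    simp

theorem normalize_mem {x : ℍ} (hx : 0 < ‖x‖) : ‖x‖⁻¹ • x ∈ Metric.sphere (0 : ℍ) 1 := by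
  rw [mem_sphere_zero_iff_norm, norm_smul, norm_inv, norm_norm, inv_mul_cancel₀ hx.ne']

theorem entry_01 (A : Sp11) : A.1 0 1 =
    (‖A.1 0 0‖⁻¹ • A.1 0 0) * star (A.1 1 0) * (‖A.1 1 1‖⁻¹ • A.1 1 1) := by
  have h := (mem_iff_entries.1 A.2).2.1
  rw [sub_eq_zero] at h
  have h2 := congrArg (A.1 0 0 * ·) h
  simp only [← mul_assoc] at h2
  rw [self_mul_star_eq, Quaternion.coe_mul_eq_smul] at h2
  have hn : ‖A.1 1 1‖ = ‖A.1 0 0‖ := by rw [(norm_row_eq A).1, (norm_row_eq A).2]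
  have hp := (norm_pos A).1.ne'
  rw [smul_mul_assoc, smul_mul_assoc, mul_smul_comm, ← h2, hn, smul_smul, smul_smul]
  have : ‖A.1 0 0‖⁻¹ * ‖A.1 0 0‖⁻¹ * ‖A.1 0 0‖ ^ 2 = 1 := by field_simp
  rw [this, one_smul]

/-- The global parametrization of `Sp(1,1)`, as a homeomorphism. -/
def homeo : Sp11 ≃ₜ ℍ × Sp1 × Sp1 where
  toFun A := (A.1 1 0, ⟨‖A.1 0 0‖⁻¹ • A.1 0 0, normalize_mem (norm_pos A).1⟩,
    ⟨‖A.1 1 1‖⁻¹ • A.1 1 1, normalize_mem (norm_pos A).2⟩)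
  invFun x := ⟨paramMatrix (x.1, x.2.1, x.2.2), paramMatrix_mem _ _ _⟩
  left_inv A := by
    refine Subtype.ext (Matrix.ext fun i j => ?_)
    have h0 := (norm_row_eq A).1
    have h1 := (norm_row_eq A).2
    fin_cases i <;> fin_cases j
    · simp only [paramMatrix, Fin.zero_eta, Matrix.of_apply, Matrix.cons_val', Matrix.cons_val_zero,
        Matrix.cons_val_fin_one]
      rw [← h0, smul_smul, mul_inv_cancel₀ (norm_pos A).1.ne', one_smul]
    · exact (entry_01 A).symm
    · rfl
    · simp only [paramMatrix, Fin.mk_one, Matrix.of_apply, Matrix.cons_val', Matrix.cons_val_one,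
        Matrix.cons_val_fin_one]
      rw [← h1, smul_smul, mul_inv_cancel₀ (norm_pos A).2.ne', one_smul]
  right_inv x := by
    obtain ⟨b, u, v⟩ := x
    have hs : 0 < √(1 + ‖b‖ ^ 2) := Real.sqrt_pos.2 (by positivity)
    have key : ∀ w : Sp1, ‖√(1 + ‖b‖ ^ 2) • (w : ℍ)‖⁻¹ • √(1 + ‖b‖ ^ 2) • (w : ℍ) = w := by
      intro w
      rw [norm_smul, norm_Sp1, mul_one, Real.norm_of_nonneg hs.le, smul_smul,
        inv_mul_cancel₀ hs.ne', one_smul]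
    refine Prod.ext rfl (Prod.ext (Subtype.ext (key u)) (Subtype.ext (key v)))
  continuous_toFun := by
    have he : ∀ i j, Continuous fun A : Sp11 => A.1 i j := fun i j =>
      (continuous_apply_apply i j).comp continuous_subtype_val
    refine (he 1 0).prodMk (Continuous.prodMk ?_ ?_)
    · exact Continuous.subtype_mk
        (((he 0 0).norm.inv₀ fun A => (norm_pos A).1.ne').smul (he 0 0)) _
    · exact Continuous.subtype_mk
        (((he 1 1).norm.inv₀ fun A => (norm_pos A).2.ne').smul (he 1 1)) _
  continuous_invFun := by
    refine Continuous.subtype_mk (continuous_matrix fun i j => ?_) _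
    fin_cases i <;> fin_cases j <;> simp [paramMatrix] <;> fun_prop

/-- The model space `ℝ⁴ × ℝ³ × ℝ³` of `Sp(1,1)`. -/
abbrev Model : Type :=
  ModelProd ℍ (ModelProd (EuclideanSpace ℝ (Fin 3)) (EuclideanSpace ℝ (Fin 3)))

/-- The model with corners of `Sp(1,1)`. -/
abbrev model : ModelWithCorners ℝ (ℍ × EuclideanSpace ℝ (Fin 3) × EuclideanSpace ℝ (Fin 3)) Model :=
  𝓘(ℝ, ℍ).prod ((𝓡 3).prod (𝓡 3))

instance : ChartedSpace Model Sp11 where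
  atlas := {e | ∃ c ∈ atlas Model (ℍ × Sp1 × Sp1), e = homeo.toOpenPartialHomeomorph ≫ₕ c}
  chartAt A := homeo.toOpenPartialHomeomorph ≫ₕ chartAt Model (homeo A)
  mem_chart_source A := by simp
  chart_mem_atlas A := ⟨_, chart_mem_atlas _ _, rfl⟩

theorem chartAt_eq (A : Sp11) :
    chartAt Model A = homeo.toOpenPartialHomeomorph ≫ₕ chartAt Model (homeo A) := rfl

instance : IsManifold model ∞ Sp11 where
  compatible := by
    rintro _ _ ⟨c, hc, rfl⟩ ⟨c', hc', rfl⟩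
    have : (homeo.toOpenPartialHomeomorph ≫ₕ c).symm ≫ₕ homeo.toOpenPartialHomeomorph ≫ₕ c'
        = c.symm ≫ₕ c' := by
      rw [OpenPartialHomeomorph.trans_symm_eq_symm_trans_symm, OpenPartialHomeomorph.trans_assoc,
        ← OpenPartialHomeomorph.trans_assoc _ homeo.toOpenPartialHomeomorph,
        ← Homeomorph.symm_toOpenPartialHomeomorph, ← Homeomorph.trans_toOpenPartialHomeomorph,
        Homeomorph.symm_trans_self, Homeomorph.refl_toOpenPartialHomeomorph,
        OpenPartialHomeomorph.refl_trans]
    rw [this]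
    have : IsManifold model ∞ (ℍ × Sp1 × Sp1) := inferInstance
    exact this.compatible hc hc'

section

variable {E H N : Type*} [NormedAddCommGroup E] [NormedSpace ℝ E] [TopologicalSpace H]
  {I : ModelWithCorners ℝ E H} [TopologicalSpace N] [ChartedSpace H N]

theorem contMDiff_iff_homeo {f : N → Sp11} :
    ContMDiff I model ∞ f ↔ ContMDiff I model ∞ (fun x => homeo (f x)) := by
  refine forall_congr' fun x => ?_
  rw [contMDiffAt_iff_target, contMDiffAt_iff_target (f := fun x => homeo (f x))]
  refine and_congr ?_ Iff.rfl
  exact (homeo.comp_continuousAt_iff f x).symm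

theorem contMDiff_homeo : ContMDiff model model ∞ homeo :=
  contMDiff_iff_homeo.1 contMDiff_id

theorem contMDiff_sqrt_one_add : ContDiff ℝ ∞ fun b : ℍ => √(1 + ‖b‖ ^ 2) :=
  (contDiff_const.add (contDiff_norm_sq ℝ)).sqrt fun b => by positivity

/-- The matrix entries are smooth functions on `Sp(1,1)`. -/
theorem contMDiff_entry (i j : Fin 2) :
    ContMDiff model 𝓘(ℝ, ℍ) ∞ (fun A : Sp11 => A.1 i j) := by
  have hb : ContMDiff model 𝓘(ℝ, ℍ) ∞ (fun x : ℍ × Sp1 × Sp1 => x.1) := contMDiff_fst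
  have hu : ContMDiff model 𝓘(ℝ, ℍ) ∞ (fun x : ℍ × Sp1 × Sp1 => (x.2.1 : ℍ)) :=
    contMDiff_coe_sphere.comp (contMDiff_fst.comp contMDiff_snd)
  have hv : ContMDiff model 𝓘(ℝ, ℍ) ∞ (fun x : ℍ × Sp1 × Sp1 => (x.2.2 : ℍ)) :=
    contMDiff_coe_sphere.comp (contMDiff_snd.comp contMDiff_snd)
  have hc : ContDiff ℝ ∞ fun y : ℍ × ℍ × ℍ => paramMatrix y i j := by
    have h1 : ContDiff ℝ ∞ fun y : ℍ × ℍ × ℍ => √(1 + ‖y.1‖ ^ 2) :=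
      contMDiff_sqrt_one_add.comp contDiff_fst
    have h2 : ContDiff ℝ ∞ fun y : ℍ × ℍ × ℍ => star y.1 :=
      (LinearMap.toContinuousLinearMap (⟨⟨star, star_add⟩, Quaternion.star_smul⟩ :
        ℍ →ₗ[ℝ] ℍ)).contDiff.comp contDiff_fst
    have h3 : ContDiff ℝ ∞ fun y : ℍ × ℍ × ℍ => y.2.1 := contDiff_fst.comp contDiff_snd
    have h4 : ContDiff ℝ ∞ fun y : ℍ × ℍ × ℍ => y.2.2 := contDiff_snd.comp contDiff_snd
    fin_cases i <;> fin_cases j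
    · exact h1.smul h3
    · exact (h3.mul h2).mul h4
    · exact contDiff_fst
    · exact h1.smul h4
  have := hc.contMDiff.comp ((hb.prodMk_space (hu.prodMk_space hv)).comp contMDiff_homeo)
  refine this.congr fun A => ?_
  exact congrArg (fun B : Sp11 => B.1 i j) (homeo.symm_apply_apply A).symm

/-- `Sp(1,1)` is an embedded submanifold of the space of matrices: a map into it is smooth if and
only if it is smooth as a map into the matrices, that is, if its entries are smooth. -/
theorem contMDiff_iff [IsManifold I ∞ N] {f : N → Sp11} :
    ContMDiff I model ∞ f ↔ ∀ i j, ContMDiff I 𝓘(ℝ, ℍ) ∞ (fun x => (f x).1 i j) := by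
  refine ⟨fun h i j => (contMDiff_entry i j).comp h, fun h => ?_⟩
  rw [contMDiff_iff_homeo]
  have hpos : ∀ (g : N → ℍ), (∀ x, 0 < ‖g x‖) → ContMDiff I 𝓘(ℝ, ℍ) ∞ g →
      ContMDiff I 𝓘(ℝ, ℍ) ∞ (fun x => ‖g x‖⁻¹ • g x) := by
    intro g hg hgs
    have : ContDiffOn ℝ ∞ (fun y : ℍ => ‖y‖⁻¹ • y) {0}ᶜ := by
      intro y hy
      exact (((contDiffAt_norm ℝ hy).inv (norm_ne_zero_iff.2 hy)).smul
        contDiffAt_id).contDiffWithinAt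
    exact this.contMDiffOn.comp_contMDiff hgs fun x => norm_pos_iff.1 (hg x)
  exact (h 1 0).prodMk (((hpos _ (fun x => (norm_pos (f x)).1) (h 0 0)).codRestrict_sphere
    fun x => normalize_mem (norm_pos (f x)).1).prodMk
    ((hpos _ (fun x => (norm_pos (f x)).2) (h 1 1)).codRestrict_sphere
    fun x => normalize_mem (norm_pos (f x)).2))

end

end Sp11

/-! ### Power series of a quaternionic variable and the `*`-product

A power series `∑ qⁿ aₙ` with right coefficients is a formal power series over `ℍ`; the variable
commutes with the coefficients, so the multiplication of formal power series is
`cₙ = ∑ₖ aₖ bₙ₋ₖ`, the `*`-product. -/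

/-- `f(q) = ∑ qⁿ aₙ` on `𝔹`, where `aₙ` are the coefficients of `p`. -/
def IsSliceSeries (f : Ball → ℍ) (p : PowerSeries ℍ) : Prop :=
  ∀ q : Ball, HasSum (fun n : ℕ => (q : ℍ) ^ n * PowerSeries.coeff n p) (f q)

open Classical in
/-- The power series expansion of a slice regular function on `𝔹` (it is unique, see
`IsSliceSeries.sliceSeries_eq`). -/
def sliceSeries (f : Ball → ℍ) : PowerSeries ℍ :=
  if h : ∃ p, IsSliceSeries f p then h.choose else 0

/-- The regular product `f * g`: `(f * g)(q) = ∑ qⁿ cₙ` with `cₙ = ∑_{k ≤ n} aₖ bₙ₋ₖ`. -/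
def starMul (f g : Ball → ℍ) (q : Ball) : ℍ :=
  ∑' n : ℕ, (q : ℍ) ^ n *
    ∑ k ∈ Finset.range (n + 1),
      PowerSeries.coeff k (sliceSeries f) * PowerSeries.coeff (n - k) (sliceSeries g)

/-- The regular conjugate `fᶜ(q) = ∑ qⁿ āₙ`. -/
def regConj (f : Ball → ℍ) (q : Ball) : ℍ :=
  ∑' n : ℕ, (q : ℍ) ^ n * star (PowerSeries.coeff n (sliceSeries f))

/-- The symmetrization `fˢ = f * fᶜ`. -/
def symmetrization (f : Ball → ℍ) : Ball → ℍ := starMul f (regConj f)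

/-- The regular reciprocal `f⁻* = (1 / fˢ) fᶜ` (off the zeros of `fˢ`). -/
def starInv (f : Ball → ℍ) (q : Ball) : ℍ := (symmetrization f q)⁻¹ * regConj f q

/-- The function `l_{(a,b)}(q) = q a + b`. -/
def lin (a b : ℍ) (q : Ball) : ℍ := q * a + b

theorem IsSliceSeries.unique {f : Ball → ℍ} {p p' : PowerSeries ℍ} (h : IsSliceSeries f p)
    (h' : IsSliceSeries f p') : p = p' := by
  let s (p : PowerSeries ℍ) : FormalMultilinearSeries ℝ ℝ ℍ := fun n =>
    ContinuousMultilinearMap.mkPiRing ℝ (Fin n) (PowerSeries.coeff n p)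
  let F : ℝ → ℍ := fun x => if hx : ‖(x : ℍ)‖ < 1 then f ⟨x, mem_ball_zero_iff.2 hx⟩ else 0
  have key : ∀ p, IsSliceSeries f p → HasFPowerSeriesAt F (s p) 0 := by
    intro p hp
    rw [hasFPowerSeriesAt_iff]
    filter_upwards [Metric.ball_mem_nhds (0 : ℝ) one_pos] with x hx
    have hx' : ‖(x : ℍ)‖ < 1 := by
      rw [Quaternion.norm_coe]; exact mem_ball_zero_iff.1 hx
    have := hp ⟨x, mem_ball_zero_iff.2 hx'⟩
    have hF : F (0 + x) = f ⟨x, mem_ball_zero_iff.2 hx'⟩ := by rw [zero_add]; exact dif_pos hx'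
    have he : (fun n => x ^ n • (s p).coeff n) =
        fun n => (x : ℍ) ^ n * PowerSeries.coeff n p := by
      funext n
      rw [← Quaternion.coe_pow, Quaternion.coe_mul_eq_smul]
      simp [s, FormalMultilinearSeries.coeff]
    rw [hF, he]
    exact this
  have := (key p h).eq_formalMultilinearSeries (key p' h')
  ext1 n
  have h2 := congrArg (fun t : FormalMultilinearSeries ℝ ℝ ℍ => t n (fun _ => 1)) this
  simpa [s] using h2

theorem IsSliceSeries.sliceSeries_eq {f : Ball → ℍ} {p : PowerSeries ℍ} (h : IsSliceSeries f p) :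
    sliceSeries f = p := by
  have hex : ∃ p, IsSliceSeries f p := ⟨p, h⟩
  rw [sliceSeries, dif_pos hex]
  exact hex.choose_spec.unique h

theorem coeff_zero_lin (a b : ℍ) :
    PowerSeries.coeff 0 (PowerSeries.C b + PowerSeries.X * PowerSeries.C a) = b := by
  rw [map_add, PowerSeries.coeff_zero_X_mul, PowerSeries.coeff_C, if_pos rfl, add_zero]

theorem coeff_one_lin (a b : ℍ) :
    PowerSeries.coeff 1 (PowerSeries.C b + PowerSeries.X * PowerSeries.C a) = a := by
  rw [map_add, PowerSeries.coeff_succ_X_mul, PowerSeries.coeff_C, PowerSeries.coeff_C,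
    if_neg one_ne_zero, if_pos rfl, zero_add]

theorem coeff_add_two_lin (a b : ℍ) (n : ℕ) :
    PowerSeries.coeff (n + 2) (PowerSeries.C b + PowerSeries.X * PowerSeries.C a) = 0 := by
  rw [map_add, PowerSeries.coeff_succ_X_mul, PowerSeries.coeff_C, PowerSeries.coeff_C,
    if_neg (by omega), if_neg (by omega), zero_add]

theorem isSliceSeries_lin (a b : ℍ) :
    IsSliceSeries (lin a b) (PowerSeries.C b + PowerSeries.X * PowerSeries.C a) := by
  intro q
  have := hasSum_sum_of_ne_finset_zero (L := SummationFilter.unconditional ℕ) (s := Finset.range 2)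
    (f := fun n => (q : ℍ) ^ n * PowerSeries.coeff n
      (PowerSeries.C b + PowerSeries.X * PowerSeries.C a)) (by
      intro n hn
      obtain ⟨m, rfl⟩ : ∃ m, n = m + 2 := ⟨n - 2, by simp at hn; omega⟩
      rw [coeff_add_two_lin, mul_zero])
  rw [Finset.sum_range_succ, Finset.sum_range_one, coeff_zero_lin, coeff_one_lin, pow_zero, pow_one,
    one_mul] at this
  have e : lin a b q = b + q * a := add_comm _ _
  rw [e]
  exact this

theorem starMul_eq {f g F : Ball → ℍ} {p r : PowerSeries ℍ} (hf : IsSliceSeries f p)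
    (hg : IsSliceSeries g r) (hF : IsSliceSeries F (p * r)) : starMul f g = F := by
  funext q
  rw [starMul, hf.sliceSeries_eq, hg.sliceSeries_eq, ← (hF q : HasSum _ _).tsum_eq]
  refine tsum_congr fun n => ?_
  rw [PowerSeries.coeff_mul, Finset.Nat.sum_antidiagonal_eq_sum_range_succ_mk]

theorem regConj_lin (a b : ℍ) : regConj (lin a b) = lin (star a) (star b) := by
  funext q
  rw [regConj, (isSliceSeries_lin a b).sliceSeries_eq, ← (isSliceSeries_lin _ _ q : HasSum _ _).tsum_eq]
  refine tsum_congr fun n => ?_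
  congr 1
  rcases n with _ | _ | n
  · rw [coeff_zero_lin, coeff_zero_lin]
  · rw [coeff_one_lin, coeff_one_lin]
  · rw [coeff_add_two_lin, coeff_add_two_lin, star_zero]

/-- `∑ qⁿ (aₙ b + aₙ₋₁ a) = f(q) b + q f(q) a`. -/
theorem IsSliceSeries.mul_lin {f : Ball → ℍ} {p : PowerSeries ℍ} (h : IsSliceSeries f p)
    (a b : ℍ) : IsSliceSeries (fun q => f q * b + q * f q * a)
      (p * (PowerSeries.C b + PowerSeries.X * PowerSeries.C a)) := by
  intro q
  have h1 := (h q).mul_right b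
  have h2 : HasSum (fun n : ℕ => (q : ℍ) ^ n * PowerSeries.coeff n
      (PowerSeries.X * (p * PowerSeries.C a))) (q * f q * a) := by
    rw [← hasSum_nat_add_iff' 1]
    simpa [pow_succ', mul_assoc, PowerSeries.coeff_succ_X_mul] using
      ((h q).mul_left (q : ℍ)).mul_right a
  have h3 : (fun n : ℕ => (q : ℍ) ^ n * PowerSeries.coeff n
      (p * (PowerSeries.C b + PowerSeries.X * PowerSeries.C a))) = fun n : ℕ =>
      (q : ℍ) ^ n * PowerSeries.coeff n p * b + (q : ℍ) ^ n * PowerSeries.coeff n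
      (PowerSeries.X * (p * PowerSeries.C a)) := by
    funext n
    rw [mul_add p, ← mul_assoc p, (PowerSeries.commute_X p).eq, mul_assoc PowerSeries.X, map_add,
      PowerSeries.coeff_mul_C, mul_add, mul_assoc]
  rw [h3]
  exact h1.add h2

/-- `l_{(c,d)}ˢ(q) = |d|² + 2 Re(c d̄) q + |c|² q²`. -/
theorem symmetrization_lin (c d : ℍ) (q : Ball) :
    symmetrization (lin c d) q = d * star d + q * (c * star d + d * star c) + q ^ 2 * (c * star c) := by
  rw [symmetrization, regConj_lin, starMul_eq (isSliceSeries_lin c d) (isSliceSeries_lin _ _)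
    ((isSliceSeries_lin c d).mul_lin _ _)]
  have h1 : (q : ℍ) * d * star c = q * (d * star c) := mul_assoc _ _ _
  simp only [lin]
  noncomm_ring

/-- The coefficients `(-d⁻¹c)ⁿ d⁻¹` of the reciprocal of `l_{(c,d)}`. -/
def invSeries (c d : ℍ) : PowerSeries ℍ := PowerSeries.mk fun n => (-(d⁻¹ * c)) ^ n * d⁻¹

/-- For `|c| < |d|`, the reciprocal of `l_{(c,d)}` is defined on all of `𝔹`, it has the expected power
series, and it is the inverse of `l_{(c,d)}` for the regular product. -/
theorem starInv_lin {c d : ℍ} (h : ‖c‖ < ‖d‖) :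
    IsSliceSeries (starInv (lin c d)) (invSeries c d) ∧
      (∀ q : Ball, symmetrization (lin c d) q ≠ 0) ∧
      ∀ q : Ball, q * starInv (lin c d) q * c + starInv (lin c d) q * d = 1 := by
  have hd : d ≠ 0 := norm_pos_iff.1 ((norm_nonneg c).trans_lt h)
  obtain ⟨r, hr⟩ : ∃ r, r = -(d⁻¹ * c) := ⟨_, rfl⟩
  have hr1 : ‖r‖ < 1 := by
    rw [hr, norm_neg, norm_mul, norm_inv, inv_mul_lt_iff₀ (norm_pos_iff.2 hd), mul_one]
    exact h
  have hc : c = -(d * r) := by rw [hr, mul_neg, neg_neg, mul_inv_cancel_left₀ hd]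
  have hrt : r + star r = ((2 * r.re : ℝ) : ℍ) := by rw [Quaternion.self_add_star]; push_cast; rfl
  have hrm : r * star r = ((‖r‖ ^ 2 : ℝ) : ℍ) := Sp11.self_mul_star_eq r
  have hdN : d * star d = ((‖d‖ ^ 2 : ℝ) : ℍ) := Sp11.self_mul_star_eq d
  have hsc : star c = -(star r * star d) := by rw [hc]; simp
  have hN0 : ((‖d‖ ^ 2 : ℝ) : ℍ) ≠ 0 := by
    rw [← hdN]; exact mul_ne_zero hd (star_ne_zero.2 hd)
  generalize ‖d‖ ^ 2 = N at hdN hN0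
  generalize 2 * r.re = t at hrt
  generalize ‖r‖ ^ 2 = m at hrm
  have main : ∀ q : Ball, ∃ g : ℍ, HasSum (fun n : ℕ => (q : ℍ) ^ n * r ^ n) g ∧
      g - q * g * r = 1 ∧ symmetrization (lin c d) q ≠ 0 ∧
      starInv (lin c d) q = g * d⁻¹ := by
    intro q
    have hq := norm_lt_one q
    have hsum : Summable (fun n : ℕ => (q : ℍ) ^ n * r ^ n) := by
      refine Summable.of_norm_bounded (summable_geometric_of_lt_one (norm_nonneg r) hr1) fun n => ?_
      rw [norm_mul, norm_pow, norm_pow]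
      exact mul_le_of_le_one_left (by positivity) (pow_le_one₀ (norm_nonneg _) hq.le)
    obtain ⟨g, hg⟩ := hsum
    have hg1 : g - q * g * r = 1 := by
      have h1 : HasSum (fun n : ℕ => (q : ℍ) ^ (n + 1) * r ^ (n + 1)) (q * g * r) := by
        have := (hg.mul_left (q : ℍ)).mul_right r
        simpa only [pow_succ' (q : ℍ), pow_succ r, mul_assoc] using this
      have h2 := (hasSum_nat_add_iff (f := fun n : ℕ => (q : ℍ) ^ n * r ^ n) 1).1 h1
      have h3 := hg.unique h2
      simp only [Finset.sum_range_one, pow_zero, mul_one] at h3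
      rw [sub_eq_iff_eq_add, add_comm]
      exact h3
    have hS : symmetrization (lin c d) q = (N : ℍ) * (1 - t * q + m * q ^ 2) := by
      have e1 : c * star d + d * star c = -((t : ℍ) * N) := by
        rw [hsc, hc, ← hdN, ← hrt, hrt, ← mul_assoc, Quaternion.coe_commutes t d, ← hrt]
        noncomm_ring
      have e2 : c * star c = (m : ℍ) * N := by
        rw [hsc, hc, ← hdN, ← mul_assoc, Quaternion.coe_commutes m d, ← hrm]
        noncomm_ring
      rw [symmetrization_lin, hdN, e1, e2]
      have c1 : (q : ℍ) * (t * N) = N * (t * q) := by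
        rw [← mul_assoc, ← Quaternion.coe_commutes t, ← Quaternion.coe_commutes N]
      have c2 : (q : ℍ) ^ 2 * (m * N) = N * (m * q ^ 2) := by
        rw [← mul_assoc, ← Quaternion.coe_commutes m, ← Quaternion.coe_commutes N]
      rw [mul_neg, c1, c2]
      noncomm_ring
    have hDg : (1 - t * (q : ℍ) + m * (q : ℍ) ^ 2) * g = 1 - (q : ℍ) * star r := by
      have c1 : (t : ℍ) * q * g = q * g * (r + star r) := by
        rw [hrt, mul_assoc, Quaternion.coe_commutes]
      have c2 : (m : ℍ) * q ^ 2 * g = q ^ 2 * g * (r * star r) := by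
        rw [hrm, mul_assoc, Quaternion.coe_commutes]
      calc (1 - t * (q : ℍ) + m * (q : ℍ) ^ 2) * g = g - t * (q : ℍ) * g + m * (q : ℍ) ^ 2 * g := by noncomm_ring
        _ = (g - (q : ℍ) * g * r) - q * (g - q * g * r) * star r := by rw [c1, c2]; noncomm_ring
        _ = 1 - (q : ℍ) * star r := by rw [hg1, mul_one]
    have hD : (1 - t * q + m * q ^ 2 : ℍ) ≠ 0 := by
      intro h0
      rw [h0, zero_mul] at hDg
      have h1 : ‖(q : ℍ) * star r‖ = 1 := by rw [← sub_eq_zero.1 hDg.symm, norm_one]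
      rw [norm_mul, Quaternion.norm_star] at h1
      exact absurd h1 (mul_lt_one_of_nonneg_of_lt_one_left (norm_nonneg _) hq hr1.le).ne
    have hS0 : symmetrization (lin c d) q ≠ 0 := hS ▸ mul_ne_zero hN0 hD
    refine ⟨g, hg, hg1, hS0, ?_⟩
    rw [starInv, inv_mul_eq_iff_eq_mul₀ hS0, hS, regConj_lin, lin, hsc]
    have e : star d = (N : ℍ) * d⁻¹ := by
      rw [Quaternion.coe_commutes, ← hdN, inv_mul_cancel_left₀ hd]
    calc (q : ℍ) * -(star r * star d) + star d = (1 - q * star r) * star d := by noncomm_ring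
      _ = (1 - t * q + m * q ^ 2) * g * (N * d⁻¹) := by rw [hDg, e]
      _ = N * (1 - t * q + m * q ^ 2) * (g * d⁻¹) := by
        rw [← mul_assoc _ (N : ℍ), ← Quaternion.coe_commutes N]
        noncomm_ring
  refine ⟨fun q => ?_, fun q => ?_, fun q => ?_⟩
  · obtain ⟨g, hg, -, -, h4⟩ := main q
    have := hg.mul_right d⁻¹
    rw [h4]
    simpa only [invSeries, PowerSeries.coeff_mk, ← hr, mul_assoc] using this
  · exact (main q).choose_spec.2.2.1
  · obtain ⟨g, hg, h2, -, h4⟩ := main q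
    rw [h4, inv_mul_cancel_right₀ hd, ← h2, hr]
    noncomm_ring

/-! ### Regular Möbius transformations -/

/-- `l_{(c,d)}⁻* * l_{(a,b)}` for a matrix `A = (a, c; b, d)`. -/
def mobiusFun (A : Matrix (Fin 2) (Fin 2) ℍ) : Ball → ℍ :=
  starMul (starInv (lin (A 0 1) (A 1 1))) (lin (A 0 0) (A 1 0))

theorem mobiusFun_eq (A : Sp11) (q : Ball) : mobiusFun A q =
    starInv (lin (A.1 0 1) (A.1 1 1)) q * A.1 1 0
      + q * starInv (lin (A.1 0 1) (A.1 1 1)) q * A.1 0 0 := by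
  have h := (starInv_lin (Sp11.norm_01_lt A)).1
  rw [mobiusFun, starMul_eq h (isSliceSeries_lin _ _) (h.mul_lin _ _)]

theorem norm_mul_add_lt (A : Sp11) {p : ℍ} (hp : ‖p‖ < 1) :
    ‖p * A.1 0 0 + A.1 1 0‖ < ‖p * A.1 0 1 + A.1 1 1‖ := by
  obtain ⟨h1, h2, h3, h4⟩ := Sp11.row_entries A
  have key : (p * A.1 0 0 + A.1 1 0) * star (p * A.1 0 0 + A.1 1 0)
      - (p * A.1 0 1 + A.1 1 1) * star (p * A.1 0 1 + A.1 1 1) = p * star p - 1 := by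
    calc _ = p * (A.1 0 0 * star (A.1 0 0) - A.1 0 1 * star (A.1 0 1)) * star p
          + p * (A.1 0 0 * star (A.1 1 0) - A.1 0 1 * star (A.1 1 1))
          + (A.1 1 0 * star (A.1 0 0) - A.1 1 1 * star (A.1 0 1)) * star p
          + (A.1 1 0 * star (A.1 1 0) - A.1 1 1 * star (A.1 1 1)) := by
          simp only [star_add, star_mul]; noncomm_ring
      _ = p * star p - 1 := by rw [h1, h2, h3, h4]; simp [sub_eq_add_neg]
  simp only [Sp11.self_mul_star_eq] at key
  have key2 : ‖p * A.1 0 0 + A.1 1 0‖ ^ 2 - ‖p * A.1 0 1 + A.1 1 1‖ ^ 2 = ‖p‖ ^ 2 - 1 := by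
    refine Quaternion.coe_injective ?_
    push_cast at key ⊢
    exact key
  refine lt_of_pow_lt_pow_left₀ 2 (norm_nonneg _) ?_
  have : ‖p‖ ^ 2 < 1 := pow_lt_one₀ (norm_nonneg _) hp two_ne_zero
  linarith

/-- A regular Möbius transformation maps `𝔹` to `𝔹`. -/
theorem mobiusFun_mem (A : Sp11) (q : Ball) : mobiusFun A q ∈ Metric.ball (0 : ℍ) 1 := by
  rw [mem_ball_zero_iff, mobiusFun_eq]
  have h := (starInv_lin (Sp11.norm_01_lt A)).2.2 q
  generalize starInv (lin (A.1 0 1) (A.1 1 1)) q = G at h ⊢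
  have hG : G ≠ 0 := by rintro rfl; simp at h
  have hp : ‖G⁻¹ * q * G‖ < 1 := by
    rw [norm_mul, norm_mul, norm_inv, mul_right_comm, inv_mul_cancel₀ (norm_ne_zero_iff.2 hG),
      one_mul]
    exact norm_lt_one q
  have h1 := norm_mul_add_lt A hp
  have e : ∀ x y : ℍ, G * (G⁻¹ * q * G * x + y) = G * y + q * G * x := by
    intro x y
    rw [mul_add, mul_assoc, mul_assoc, mul_inv_cancel_left₀ hG, add_comm, mul_assoc]
  rw [← e]
  have h2 : G * (G⁻¹ * q * G * A.1 0 1 + A.1 1 1) = 1 := by rw [e, add_comm]; exact h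
  have h3 := congrArg norm h2
  rw [norm_mul, norm_one] at h3
  rw [norm_mul, ← h3]
  exact mul_lt_mul_of_pos_left h1 (norm_pos_iff.2 hG)

/-- The regular Möbius transformation `𝓕_A : 𝔹 → 𝔹`, `𝓕_A(q) = (qc + d)⁻* * (qa + b)`, of
`A = (a, c; b, d) ∈ Sp(1,1)`. -/
def mobius (A : Sp11) (q : Ball) : Ball := ⟨mobiusFun A q, mobiusFun_mem A q⟩

/-- The set of all regular Möbius transformations of `𝔹`. -/
def mobiusSet : Set (Ball → Ball) := Set.range mobius

/-- `𝓜(𝔹)`, the set of regular Möbius transformations, as a type.  It carries no topology by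
default. -/
def MB : Type := mobiusSet

namespace MB

instance : CoeFun MB (fun _ => Ball → Ball) := ⟨fun F => F.1⟩

/-- The map `Sp(1,1) → 𝓜(𝔹)`, `A ↦ 𝓕_{A⁻¹}`; its fibers are the cosets `A Sp(1)I₂`. -/
def proj (A : Sp11) : MB := ⟨mobius A⁻¹, A⁻¹, rfl⟩

/-- The manifold structure of `𝓜(𝔹) ≃ Sp(1,1)/Sp(1)I₂`: the smooth manifold structure, of dimension
`7`, with the quotient topology, for which `A ↦ 𝓕_{A⁻¹}` is a submersion, i.e. smooth and surjective
with surjective differential at every point. -/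
structure IsQuotientManifold [TopologicalSpace MB] [ChartedSpace (EuclideanSpace ℝ (Fin 7)) MB] :
    Prop where
  isManifold : IsManifold (𝓡 7) ∞ MB
  t2Space : T2Space MB
  secondCountableTopology : SecondCountableTopology MB
  isQuotientMap : Topology.IsQuotientMap proj
  contMDiff_proj : ContMDiff Sp11.model (𝓡 7) ∞ proj
  surjective_mfderiv : ∀ A : Sp11, Function.Surjective (mfderiv Sp11.model (𝓡 7) proj A)

/-- `𝓜(𝔹)₀`, the elements of `𝓜(𝔹)` that fix the origin. -/
def isotropy : Set MB := {F | F 0 = 0}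

end MB

/-- `R_u(q) = q u`. -/
def R (u : Sp1) (q : Ball) : Ball :=
  ⟨q * u, mem_ball_zero_iff.2 (by rw [norm_mul, norm_Sp1, mul_one]; exact norm_lt_one q)⟩

end RegMobius

end

/-!
Multiplying `A ∈ Sp(1,1)` on the left by `v I₂` does not change `𝓕_A`, and exactly one matrix in
each coset `Sp(1)I₂ A` has a positive real lower right entry. That matrix is determined by its lower
left entry `b` and a unit quaternion `u`, and both can be read off from the transformation: `b` from
`𝓕_A(0) = b / √(1 + |b|²)`, and then `u` from the value at `1/2`. So `(b, u)` are global
coordinates identifying `𝓜(𝔹)` with `ℍ × Sp(1)`, and transporting the manifold structure along them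
gives the required structure on `𝓜(𝔹)`. It is the only one: for any other, the coordinates are a
smooth homeomorphism between manifolds of the same dimension with surjective differential, hence a
diffeomorphism. In these coordinates the evaluation map is an explicit smooth expression, and the
isotropy at `0` is the slice `b = 0`, where the transformation with coordinates `(0, u)` is `R_u`.

Products of matrices do not correspond to compositions of maps. However, at a point that commutes
with `c` and `d` the regular quotient `(qc + d)⁻* * (qa + b)` is the pointwise quotient, and there
they do. Transitivity follows by moving `p` to `0` and `0` to `q` with matrices for which these
commutation relations hold.
-/

noncomputable section

namespace RegMobius

section Transport

variable {𝕜 E E' H H' X M : Type*} [NontriviallyNormedField 𝕜]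
  [NormedAddCommGroup E] [NormedSpace 𝕜 E] [NormedAddCommGroup E'] [NormedSpace 𝕜 E']
  [TopologicalSpace H] [TopologicalSpace H'] [TopologicalSpace X] [TopologicalSpace M]

/-- The chart `L ∘ c ∘ e⁻¹` of `M` obtained from a chart `c` of `X`, where `e : X ≃ₜ M` and `L` is a
homeomorphism of the model spaces. -/
def transportChart (e : X ≃ₜ M) (L : H ≃ₜ H') (c : OpenPartialHomeomorph X H) :
    OpenPartialHomeomorph M H' :=
  e.symm.toOpenPartialHomeomorph ≫ₕ c ≫ₕ L.toOpenPartialHomeomorph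

/-- The charted space structure on `M` transported from `X` along a homeomorphism `e`, with the
model space changed along `L`. -/
@[reducible]
def transportChartedSpace [ChartedSpace H X] (e : X ≃ₜ M) (L : H ≃ₜ H') : ChartedSpace H' M where
  atlas := transportChart e L '' atlas H X
  chartAt m := transportChart e L (chartAt H (e.symm m))
  mem_chart_source m := by simp [transportChart]
  chart_mem_atlas m := Set.mem_image_of_mem _ (chart_mem_atlas _ _)

variable [ChartedSpace H X] {I : ModelWithCorners 𝕜 E H} {I' : ModelWithCorners 𝕜 E' H'}
  {n : WithTop ℕ∞}

theorem transportChart_mem_maximalAtlas [ChartedSpace H' M] [IsManifold I n X] [IsManifold I' n M]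
    (e : X ≃ₘ^n⟮I, I'⟯ M) (L : H ≃ₘ^n⟮I, I'⟯ H')
    {c : OpenPartialHomeomorph X H} (hc : c ∈ IsManifold.maximalAtlas I n X) :
    transportChart e.toHomeomorph L.toHomeomorph c ∈ IsManifold.maximalAtlas I' n M := by
  have h_chart := L.contMDiff.comp_contMDiffOn
    ((contMDiffOn_of_mem_maximalAtlas hc).comp' (e.symm.contMDiff.contMDiffOn (s := Set.univ)))
  have h_symm := e.contMDiff.comp_contMDiffOn
    ((contMDiffOn_symm_of_mem_maximalAtlas hc).comp'
      (L.symm.contMDiff.contMDiffOn (s := Set.univ)))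
  refine OpenPartialHomeomorph.mem_maximalAtlas_of_contMDiffOn _ ?_ ?_
  · exact h_chart.mono fun m hm => by simpa [transportChart] using hm
  · exact h_symm.mono fun y hy => by simpa [transportChart] using hy

variable [IsManifold I n X]

theorem contMDiffOn_transportChart_transition (e : X ≃ₜ M) (L : H ≃ₘ^n⟮I, I'⟯ H')
    {c c' : OpenPartialHomeomorph X H} (hc : c ∈ atlas H X) (hc' : c' ∈ atlas H X) :
    ContMDiffOn I' I' n
      ((transportChart e L.toHomeomorph c).symm ≫ₕ transportChart e L.toHomeomorph c')
      ((transportChart e L.toHomeomorph c).symm ≫ₕ transportChart e L.toHomeomorph c').source := by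
  have h_symm := contMDiffOn_symm_of_mem_maximalAtlas
    (IsManifold.subset_maximalAtlas (I := I) (n := n) hc)
  have h_chart := contMDiffOn_of_mem_maximalAtlas
    (IsManifold.subset_maximalAtlas (I := I) (n := n) hc')
  have h_conj := L.contMDiff.comp_contMDiffOn
    (h_chart.comp' (h_symm.comp' (L.symm.contMDiff.contMDiffOn (s := Set.univ))))
  refine (h_conj.congr fun y _ => ?_).mono fun y hy => ?_
  · simp [transportChart]
  · simpa [transportChart, and_assoc] using hy

theorem isManifold_transportChartedSpace (e : X ≃ₜ M) (L : H ≃ₘ^n⟮I, I'⟯ H') :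
    letI := transportChartedSpace e L.toHomeomorph
    IsManifold I' n M := by
  let _ := transportChartedSpace e L.toHomeomorph
  refine isManifold_of_contDiffOn I' n M ?_
  rintro _ _ ⟨c, hc, rfl⟩ ⟨c', hc', rfl⟩
  rw [← contMDiffOn_iff_contDiffOn]
  exact I'.contMDiff.comp_contMDiffOn <| (contMDiffOn_transportChart_transition e L hc hc').comp
    (I'.contMDiffOn_symm.mono Set.inter_subset_right) fun y hy => hy.1

theorem chartAt_transportChartedSpace (e : X ≃ₜ M) (L : H ≃ₜ H') (x : X) :
    letI := transportChartedSpace e L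
    chartAt H' (e x) = transportChart e L (chartAt H x) :=
  congrArg (fun y => transportChart e L (chartAt H y)) (e.symm_apply_apply x)

theorem contMDiff_transportChartedSpace (e : X ≃ₜ M) (L : H ≃ₘ^n⟮I, I'⟯ H') :
    letI := transportChartedSpace e L.toHomeomorph
    ContMDiff I I' n e := by
  let _ := transportChartedSpace e L.toHomeomorph
  have := isManifold_transportChartedSpace e L
  intro x
  have h := (contMDiffOn_chart_symm (I := I') (n := n) (x := e x)).comp'
    (L.contMDiff.comp_contMDiffOn (contMDiffOn_chart (I := I) (n := n) (x := x)))
  rw [chartAt_transportChartedSpace] at h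
  refine (h.congr (f₁ := e) fun y hy => ?_).contMDiffAt ?_
  · simp [transportChart, (chartAt H x).left_inv hy.1]
  · filter_upwards [(chartAt H x).open_source.mem_nhds (mem_chart_source H x)] with y hy
    simp [transportChart, hy, (chartAt H x).map_source hy]

theorem contMDiff_symm_transportChartedSpace (e : X ≃ₜ M) (L : H ≃ₘ^n⟮I, I'⟯ H') :
    letI := transportChartedSpace e L.toHomeomorph
    ContMDiff I' I n e.symm := by
  let _ := transportChartedSpace e L.toHomeomorph
  have := isManifold_transportChartedSpace e L
  refine e.surjective.forall.2 fun x => ?_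
  have h := (contMDiffOn_chart_symm (I := I) (n := n) (x := x)).comp'
    (L.symm.contMDiff.comp_contMDiffOn (contMDiffOn_chart (I := I') (n := n) (x := e x)))
  rw [chartAt_transportChartedSpace] at h
  have left_inv (y : X) (hy : y ∈ (chartAt H x).source) :
      (chartAt H x).symm (L.symm (L (chartAt H x y))) = y := by
    rw [L.symm_apply_apply, (chartAt H x).left_inv hy]
  refine (h.congr (f₁ := e.symm) fun m hm => ?_).contMDiffAt ?_
  · exact (left_inv (e.symm m) (by simpa [transportChart] using hm.1)).symm
  · have h_source : e.symm ⁻¹' (chartAt H x).source ∈ nhds (e x) :=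
      ((chartAt H x).open_source.preimage e.symm.continuous).mem_nhds (by simp)
    filter_upwards [h_source] with m hm
    have hm' : e.symm m ∈ (chartAt H x).source := hm
    simp [transportChart, hm', (chartAt H x).map_source hm']

/-- The homeomorphism `e`, as a diffeomorphism onto the transported manifold. -/
def transportDiffeomorph (e : X ≃ₜ M) (L : H ≃ₘ^n⟮I, I'⟯ H') :
    letI := transportChartedSpace e L.toHomeomorph
    X ≃ₘ^n⟮I, I'⟯ M :=
  letI := transportChartedSpace e L.toHomeomorph
  { toEquiv := e.toEquiv
    contMDiff_toFun := contMDiff_transportChartedSpace e L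
    contMDiff_invFun := contMDiff_symm_transportChartedSpace e L }

end Transport

section Slice

variable {𝕜 E E' F Y S M : Type*} [NontriviallyNormedField 𝕜]
  [NormedAddCommGroup E] [NormedSpace 𝕜 E] [NormedAddCommGroup E'] [NormedSpace 𝕜 E']
  [NormedAddCommGroup F] [NormedSpace 𝕜 F]
  [TopologicalSpace Y] [TopologicalSpace S] [TopologicalSpace M]
  [ChartedSpace E Y] [ChartedSpace E S] [ChartedSpace E' M] {n : WithTop ℕ∞}

/-- A continuous linear equivalence, as a diffeomorphism from the product of two model spaces. -/
def prodModelDiffeomorph (A : (F × E) ≃L[𝕜] E') :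
    ModelProd F E ≃ₘ^n⟮𝓘(𝕜, F).prod 𝓘(𝕜, E), 𝓘(𝕜, E')⟯ E' where
  toEquiv := A.toEquiv
  contMDiff_toFun := contMDiff_iff.2 ⟨A.continuous, fun _ _ => A.contDiff.contDiffOn⟩
  contMDiff_invFun := contMDiff_iff.2 ⟨A.symm.continuous, fun _ _ => A.symm.contDiff.contDiffOn⟩

theorem prodModelDiffeomorph_apply (A : (F × E) ≃L[𝕜] E') (x : ModelProd F E) :
    prodModelDiffeomorph (n := n) A x = A x :=
  rfl

variable [IsManifold 𝓘(𝕜, E) n Y] [IsManifold 𝓘(𝕜, E) n S] [IsManifold 𝓘(𝕜, E') n M]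

theorem isImmersionOfComplement_of_slice (A : (F × E) ≃L[𝕜] E')
    (φ : (F × Y) ≃ₘ^n⟮𝓘(𝕜, F).prod 𝓘(𝕜, E), 𝓘(𝕜, E')⟯ M) (ψ : Y ≃ₘ^n⟮𝓘(𝕜, E), 𝓘(𝕜, E)⟯ S)
    {ι : S → M} (hι : ∀ y, ι (ψ y) = φ (0, y)) :
    Manifold.IsImmersionOfComplement F 𝓘(𝕜, E) 𝓘(𝕜, E') n ι := by
  refine ψ.surjective.forall.2 fun y => ?_
  have h_symm (m : S) : φ.symm (ι m) = (0, ψ.symm m) := by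
    rw [← φ.symm_apply_apply (0, ψ.symm m), ← hι, ψ.apply_symm_apply]
  have h_cont : Continuous ι := by
    have h_eq : ι = fun m => φ (0, ψ.symm m) := funext fun m => by rw [← h_symm, φ.apply_symm_apply]
    rw [h_eq]
    exact φ.continuous.comp (continuous_const.prodMk ψ.symm.continuous)
  refine Manifold.IsImmersionAtOfComplement.mk_of_continuousAt h_cont.continuousAt
    ((ContinuousLinearEquiv.prodComm 𝕜 E F).trans A)
    (transportChart ψ.toHomeomorph (Diffeomorph.refl 𝓘(𝕜, E) E n).toHomeomorph (chartAt E y))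
    (transportChart φ.toHomeomorph (prodModelDiffeomorph (n := n) A).toHomeomorph
      (chartAt (ModelProd F E) ((0, y) : F × Y))) ?_ ?_
    (transportChart_mem_maximalAtlas ψ _ (IsManifold.chart_mem_maximalAtlas y))
    (transportChart_mem_maximalAtlas φ _ (IsManifold.chart_mem_maximalAtlas _)) fun z hz => ?_
  · simp [transportChart]
  · simp [transportChart, hι]
  · have hz' : z ∈ (chartAt E y).target := by simpa [transportChart] using hz
    simp [transportChart, prodModelDiffeomorph_apply, hι, chartAt_self_eq,
      (chartAt E y).right_inv hz']

end Slice

section InverseFunction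

variable {𝕜 E E' H H' X M : Type*} [NontriviallyNormedField 𝕜]
  [NormedAddCommGroup E] [NormedSpace 𝕜 E] [NormedAddCommGroup E'] [NormedSpace 𝕜 E']
  [TopologicalSpace H] [TopologicalSpace H'] [TopologicalSpace X] [TopologicalSpace M]
  [ChartedSpace H X] [ChartedSpace H' M]
  {I : ModelWithCorners 𝕜 E H} {I' : ModelWithCorners 𝕜 E' H'}
  [I.Boundaryless] [I'.Boundaryless] {n : WithTop ℕ∞}

theorem contMDiffAt_symm_of_isInvertible_mfderiv [CompleteSpace E] (e : X ≃ₜ M) {x : X}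
    (he : ContMDiffAt I I' n e x) (hn : n ≠ 0) (hd : (mfderiv I I' e x).IsInvertible) :
    ContMDiffAt I' I n e.symm (e x) := by
  let f : OpenPartialHomeomorph E E' := I.toHomeomorph.symm.toOpenPartialHomeomorph ≫ₕ
    (chartAt H x).symm ≫ₕ e.toOpenPartialHomeomorph ≫ₕ chartAt H' (e x) ≫ₕ
    I'.toHomeomorph.toOpenPartialHomeomorph
  have hf : ContDiffAt 𝕜 n f (extChartAt I x x) := by
    have := (contMDiffAt_iff.1 he).2
    rwa [I.range_eq_univ, contDiffWithinAt_univ] at this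
  obtain ⟨f', hf'⟩ : ∃ f' : E ≃L[𝕜] E', (f' : E →L[𝕜] E') = fderiv 𝕜 f (extChartAt I x x) := by
    rw [(he.mdifferentiableAt hn).mfderiv, I.range_eq_univ, fderivWithin_univ] at hd
    exact hd
  have hx : f.symm (extChartAt I' (e x) (e x)) = extChartAt I x x := by
    change extChartAt I x (e.symm ((extChartAt I' (e x)).symm _)) = _
    simp
  have hf_symm : ContDiffAt 𝕜 n f.symm (extChartAt I' (e x) (e x)) := by
    refine f.contDiffAt_symm (f₀' := f') (by simp [f]) ?_ (hx ▸ hf)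
    rw [hx, hf']
    exact (hf.differentiableAt hn).hasFDerivAt
  rw [contMDiffAt_iff, I'.range_eq_univ, contDiffWithinAt_univ, e.symm_apply_apply]
  exact ⟨e.symm.continuous.continuousAt, hf_symm⟩

variable [CompleteSpace 𝕜] [FiniteDimensional 𝕜 E] [FiniteDimensional 𝕜 E']

theorem isInvertible_of_surjective_of_finrank_eq
    (hdim : Module.finrank 𝕜 E = Module.finrank 𝕜 E') {f : E →L[𝕜] E'}
    (hf : Function.Surjective f) : f.IsInvertible :=
  have h_inj := (LinearMap.injective_iff_surjective_of_finrank_eq_finrank hdim).2 hf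
  ⟨(LinearEquiv.ofBijective f.toLinearMap ⟨h_inj, hf⟩).toContinuousLinearEquiv, rfl⟩

/-- A smooth homeomorphism between manifolds of the same finite dimension whose differential is
everywhere surjective, as a diffeomorphism. -/
def diffeomorphOfSurjectiveMFDeriv (hdim : Module.finrank 𝕜 E = Module.finrank 𝕜 E')
    (e : X ≃ₜ M) (he : ContMDiff I I' n e) (hn : n ≠ 0)
    (hd : ∀ x, Function.Surjective (mfderiv I I' e x)) : X ≃ₘ^n⟮I, I'⟯ M where
  toEquiv := e.toEquiv
  contMDiff_toFun := he
  contMDiff_invFun := by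
    have := FiniteDimensional.complete 𝕜 E
    refine e.surjective.forall.2 fun x => contMDiffAt_symm_of_isInvertible_mfderiv e (he x) hn ?_
    exact isInvertible_of_surjective_of_finrank_eq hdim (hd x)

end InverseFunction

section Submersion

variable {𝕜 E E' H H' X M : Type*} [NontriviallyNormedField 𝕜]
  [NormedAddCommGroup E] [NormedSpace 𝕜 E] [NormedAddCommGroup E'] [NormedSpace 𝕜 E']
  [TopologicalSpace H] [TopologicalSpace H'] [TopologicalSpace X] [TopologicalSpace M]
  [ChartedSpace H X] [ChartedSpace H' M]
  {I : ModelWithCorners 𝕜 E H} {I' : ModelWithCorners 𝕜 E' H'}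

theorem surjective_mfderiv_of_section {f : X → M} {s : M → X} {x : X}
    (hf : MDifferentiableAt I I' f x) (hs : MDifferentiableAt I' I s (f x)) (hx : s (f x) = x)
    (hfs : f ∘ s =ᶠ[nhds (f x)] id) : Function.Surjective (mfderiv I I' f x) := by
  have h_comp : (mfderiv I I' f x).comp (mfderiv I' I s (f x)) =
      ContinuousLinearMap.id 𝕜 (TangentSpace I' (f x)) := by
    rw [← mfderiv_id, ← hfs.mfderiv_eq, mfderiv_comp (f x) (hx.symm ▸ hf) hs, hx]
  exact fun v => ⟨mfderiv I' I s (f x) v, congrArg (· v) h_comp⟩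

end Submersion

section LieGroup

variable {𝕜 E E' H H' G K : Type*} [NontriviallyNormedField 𝕜]
  [NormedAddCommGroup E] [NormedSpace 𝕜 E] [NormedAddCommGroup E'] [NormedSpace 𝕜 E']
  [TopologicalSpace H] [TopologicalSpace H'] [TopologicalSpace G] [TopologicalSpace K]
  [ChartedSpace H G] [ChartedSpace H' K]
  {I : ModelWithCorners 𝕜 E H} {I' : ModelWithCorners 𝕜 E' H'} {n : WithTop ℕ∞}

theorem lieGroup_of_mulEquiv [Group G] [Group K] [LieGroup I n G] [IsManifold I' n K]
    (ρ : G ≃* K) (h : ContMDiff I I' n ρ) (h_symm : ContMDiff I' I n ρ.symm) :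
    LieGroup I' n K where
  contMDiff_mul :=
    (h.comp ((h_symm.comp contMDiff_fst).mul (h_symm.comp contMDiff_snd))).congr fun _ => by simp
  contMDiff_inv := (h.comp h_symm.inv).congr fun _ => by simp

end LieGroup

section NormedAlgebra

variable {𝕜 : Type*} [NontriviallyNormedField 𝕜] {n : WithTop ℕ∞}

instance contMDiffMul_normedAlgebra {A : Type*} [NormedRing A] [NormedAlgebra 𝕜 A] :
    ContMDiffMul 𝓘(𝕜, A) n A where
  contMDiff_mul := by
    rw [← modelWithCornersSelf_prod, chartedSpaceSelf_prod]
    exact contDiff_mul.contMDiff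

instance contMDiffInv₀_normedDivisionRing {A : Type*} [NormedDivisionRing A] [NormedAlgebra 𝕜 A]
    [CompleteSpace A] : ContMDiffInv₀ 𝓘(𝕜, A) n A where
  contMDiffAt_inv₀ := by
    intro x hx
    have h := contDiffAt_ringInverse 𝕜 (n := n) (Units.mk0 x hx)
    rw [Ring.inverse_eq_inv'] at h
    exact h.contMDiffAt

theorem contMDiff_star {A : Type*} [NormedAddCommGroup A] [NormedSpace 𝕜 A] [StarRing 𝕜]
    [TrivialStar 𝕜] [StarAddMonoid A] [StarModule 𝕜 A] [ContinuousStar A] :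
    ContMDiff 𝓘(𝕜, A) 𝓘(𝕜, A) n (star : A → A) :=
  (starL' 𝕜 : A ≃L[𝕜] A).contDiff.contMDiff

end NormedAlgebra

section Quaternion

theorem coe_inv_Sp1 (u : Sp1) : ((u⁻¹ : Sp1) : ℍ) = star (u : ℍ) := by
  have h : (u : ℍ) * star (u : ℍ) = 1 := by rw [Sp11.self_mul_star_eq]; simp
  rw [Metric.unitSphere.coe_inv, eq_inv_of_mul_eq_one_right h]

theorem exists_eq_norm_smul (b : ℍ) : ∃ u : Sp1, b = ‖b‖ • (u : ℍ) := by
  rcases eq_or_ne b 0 with rfl | hb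
  · exact ⟨1, by simp⟩
  · exact ⟨⟨‖b‖⁻¹ • b, Sp11.normalize_mem (norm_pos_iff.2 hb)⟩,
      (smul_inv_smul₀ (norm_ne_zero_iff.2 hb) b).symm⟩

instance : StarModule ℝ ℍ := ⟨Quaternion.star_smul⟩

instance : LieGroup (𝓡 3) ∞ Sp1 where
  contMDiff_mul := ContMDiff.codRestrict_sphere
    (f := fun x : Sp1 × Sp1 => (x.1 : ℍ) * (x.2 : ℍ))
    ((contMDiff_coe_sphere.comp contMDiff_fst).mul (contMDiff_coe_sphere.comp contMDiff_snd))
    fun x => (x.1 * x.2).2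
  contMDiff_inv := by
    refine ContMDiff.codRestrict_sphere (f := fun u : Sp1 => ((u⁻¹ : Sp1) : ℍ)) ?_ fun u => (u⁻¹).2
    simp only [coe_inv_Sp1]
    exact contMDiff_star.comp contMDiff_coe_sphere

end Quaternion

section MobiusFormulas

theorem starInv_lin_eq {c d : ℍ} (h : ‖c‖ < ‖d‖) (q : Ball) {G : ℍ}
    (hG : q * G * c + G * d = 1) : starInv (lin c d) q = G := by
  have hK := (starInv_lin h).2.2 q
  generalize starInv (lin c d) q = K at hK
  by_contra hne
  have h_diff : (q : ℍ) * (K - G) * c = -((K - G) * d) := by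
    refine eq_neg_of_add_eq_zero_left ?_
    calc (q : ℍ) * (K - G) * c + (K - G) * d
        = ((q : ℍ) * K * c + K * d) - (q * G * c + G * d) := by noncomm_ring
      _ = 0 := by rw [hK, hG, sub_self]
  have h_lt : ‖(q : ℍ) * (K - G) * c‖ < ‖-((K - G) * d)‖ := by
    have hpos : 0 < ‖K - G‖ := norm_pos_iff.2 (sub_ne_zero.2 hne)
    rw [norm_neg, norm_mul, norm_mul, norm_mul]
    calc ‖(q : ℍ)‖ * ‖K - G‖ * ‖c‖ ≤ 1 * ‖K - G‖ * ‖c‖ := by gcongr; exact (norm_lt_one q).le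
      _ < ‖K - G‖ * ‖d‖ := by rw [one_mul]; gcongr
  exact h_lt.ne (congrArg norm h_diff)

theorem mobius_apply_of_eq (A : Sp11) (q : Ball) {G : ℍ}
    (hG : q * G * A.1 0 1 + G * A.1 1 1 = 1) :
    (mobius A q : ℍ) = G * A.1 1 0 + q * G * A.1 0 0 := by
  change mobiusFun A q = _
  rw [mobiusFun_eq, starInv_lin_eq (Sp11.norm_01_lt A) q hG]

theorem denom_ne_zero (A : Sp11) {p : ℍ} (hp : ‖p‖ < 1) : p * A.1 0 1 + A.1 1 1 ≠ 0 :=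
  norm_pos_iff.1 ((norm_nonneg _).trans_lt (norm_mul_add_lt A hp))

theorem denom_mul_mobius (A : Sp11) (q : Ball) (h : ∀ i, Commute (q : ℍ) (A.1 i 1)) :
    (q * A.1 0 1 + A.1 1 1) * (mobius A q : ℍ) = q * A.1 0 0 + A.1 1 0 := by
  have hD := denom_ne_zero A (norm_lt_one q)
  have hq : Commute (q : ℍ) (q * A.1 0 1 + A.1 1 1)⁻¹ :=
    (((Commute.refl _).mul_right (h 0)).add_right (h 1)).inv_right₀
  rw [mobius_apply_of_eq A q (G := (q * A.1 0 1 + A.1 1 1)⁻¹), hq.eq, mul_assoc, ← mul_add,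
    mul_inv_cancel_left₀ hD, add_comm]
  rw [hq.eq, mul_assoc, ← mul_add, inv_mul_cancel₀ hD]

theorem mobius_mul_apply (A B : Sp11) (q : Ball) (hA : ∀ i, Commute (q : ℍ) (A.1 i 1))
    (hB : ∀ i, Commute (mobius A q : ℍ) (B.1 i 1))
    (hAB : ∀ i, Commute (q : ℍ) ((A * B).1 i 1)) :
    mobius (A * B) q = mobius B (mobius A q) := by
  have entry (i j : Fin 2) : (A * B).1 i j = A.1 i 0 * B.1 0 j + A.1 i 1 * B.1 1 j := by
    simp [Matrix.mul_apply, Fin.sum_univ_two]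
  have row (j : Fin 2) : (q : ℍ) * (A * B).1 0 j + (A * B).1 1 j =
      (q * A.1 0 1 + A.1 1 1) * (mobius A q * B.1 0 j + B.1 1 j) := by
    rw [entry, entry, mul_add _ _ (B.1 1 j), ← mul_assoc _ _ (B.1 0 j), denom_mul_mobius A q hA]
    noncomm_ring
  refine Subtype.ext (mul_left_cancel₀ (denom_ne_zero (A * B) (norm_lt_one q)) ?_)
  rw [denom_mul_mobius _ q hAB, row, row, mul_assoc, denom_mul_mobius B _ hB]

theorem mobius_eq_of_mul_left {A B : Sp11} {v : ℍ} (hv : v ≠ 0)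
    (h : ∀ i j, B.1 i j = v * A.1 i j) : mobius B = mobius A := by
  funext q
  have hG := (starInv_lin (Sp11.norm_01_lt A)).2.2 q
  have cancel (G x : ℍ) : G * v⁻¹ * (v * x) = G * x := by
    rw [mul_assoc, inv_mul_cancel_left₀ hv]
  refine Subtype.ext ?_
  rw [mobius_apply_of_eq A q hG, mobius_apply_of_eq B q
    (G := starInv (lin (A.1 0 1) (A.1 1 1)) q * v⁻¹)] <;>
  rw [h, h, cancel, ← mul_assoc (q : ℍ), cancel]
  exact hG

theorem mobius_zero (A : Sp11) : (mobius A 0 : ℍ) = (A.1 1 1)⁻¹ * A.1 1 0 := by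
  have hd : A.1 1 1 ≠ 0 := norm_pos_iff.1 (Sp11.norm_pos A).2
  rw [eq_inv_mul_iff_mul_eq₀ hd]
  simpa using denom_mul_mobius A 0 fun i => Commute.zero_left _

end MobiusFormulas

section Evaluation

theorem contMDiff_symmetrization_lin : ContMDiff (Sp11.model.prod 𝓘(ℝ, ℍ)) 𝓘(ℝ, ℍ) ∞
    fun x : Sp11 × Ball => symmetrization (lin (x.1.1 0 1) (x.1.1 1 1)) x.2 := by
  have h_entry (i j : Fin 2) : ContMDiff (Sp11.model.prod 𝓘(ℝ, ℍ)) 𝓘(ℝ, ℍ) ∞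
      fun x : Sp11 × Ball => x.1.1 i j := (Sp11.contMDiff_entry i j).comp contMDiff_fst
  have h_star (i j : Fin 2) : ContMDiff (Sp11.model.prod 𝓘(ℝ, ℍ)) 𝓘(ℝ, ℍ) ∞
      fun x : Sp11 × Ball => star (x.1.1 i j) := contMDiff_star.comp (h_entry i j)
  have h_point : ContMDiff (Sp11.model.prod 𝓘(ℝ, ℍ)) 𝓘(ℝ, ℍ) ∞
      fun x : Sp11 × Ball => (x.2 : ℍ) := contMDiff_subtype_val.comp contMDiff_snd
  simp only [symmetrization_lin, sq]
  exact (((h_entry 1 1).mul (h_star 1 1)).add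
    (h_point.mul (((h_entry 0 1).mul (h_star 1 1)).add ((h_entry 1 1).mul (h_star 0 1))))).add
    ((h_point.mul h_point).mul ((h_entry 0 1).mul (h_star 0 1)))

theorem contMDiff_starInv_lin : ContMDiff (Sp11.model.prod 𝓘(ℝ, ℍ)) 𝓘(ℝ, ℍ) ∞
    fun x : Sp11 × Ball => starInv (lin (x.1.1 0 1) (x.1.1 1 1)) x.2 := by
  have h_star (i j : Fin 2) : ContMDiff (Sp11.model.prod 𝓘(ℝ, ℍ)) 𝓘(ℝ, ℍ) ∞
      fun x : Sp11 × Ball => star (x.1.1 i j) :=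
    contMDiff_star.comp ((Sp11.contMDiff_entry i j).comp contMDiff_fst)
  simp only [starInv, regConj_lin, lin]
  refine (contMDiff_symmetrization_lin.inv₀ fun x => ?_).mul
    (((contMDiff_subtype_val.comp contMDiff_snd).mul (h_star 0 1)).add (h_star 1 1))
  exact (starInv_lin (Sp11.norm_01_lt x.1)).2.1 x.2

theorem contMDiff_mobius : ContMDiff (Sp11.model.prod 𝓘(ℝ, ℍ)) 𝓘(ℝ, ℍ) ∞
    fun x : Sp11 × Ball => mobius x.1 x.2 := by
  have h_entry (i j : Fin 2) : ContMDiff (Sp11.model.prod 𝓘(ℝ, ℍ)) 𝓘(ℝ, ℍ) ∞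
      fun x : Sp11 × Ball => x.1.1 i j := (Sp11.contMDiff_entry i j).comp contMDiff_fst
  rw [← ContMDiff.subtypeVal_comp_iff]
  exact ((contMDiff_starInv_lin.mul (h_entry 1 0)).add
    (((contMDiff_subtype_val.comp contMDiff_snd).mul contMDiff_starInv_lin).mul
      (h_entry 0 0))).congr fun x => mobiusFun_eq x.1 x.2

end Evaluation

section Coordinates

/-- The space `ℍ × Sp(1)` of coordinates of `𝓜(𝔹)`. -/
abbrev Coord : Type := ℍ × Sp1

/-- The model with corners of the space of coordinates. -/
abbrev coordModel : ModelWithCorners ℝ (ℍ × EuclideanSpace ℝ (Fin 3))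
    (ModelProd ℍ (EuclideanSpace ℝ (Fin 3))) := 𝓘(ℝ, ℍ).prod (𝓡 3)

/-- The representative `(s u, u b̄; b, s)`, with `s = √(1 + |b|²)`, of the coset with coordinates
`(b, u)` in `Sp(1)I₂ \ Sp(1,1)`: the one whose lower right entry is a positive real number. Left
cosets occur because `𝓕_A` is unchanged when `A` is multiplied on the left by `v I₂`. -/
def normalForm (x : Coord) : Sp11 := Sp11.homeo.symm (x.1, x.2, 1)

/-- The element `v I₂ * normalForm x` of the coset with coordinates `x`. -/
def cosetRep (v : Sp1) (x : Coord) : Sp11 := Sp11.homeo.symm (v * x.1, v * x.2, v)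

/-- The coordinates of the coset of `A` in `Sp(1)I₂ \ Sp(1,1)`. -/
def cosetCoord (A : Sp11) : Coord :=
  ((((Sp11.homeo A).2.2⁻¹ : Sp1) : ℍ) * (Sp11.homeo A).1,
    (Sp11.homeo A).2.2⁻¹ * (Sp11.homeo A).2.1)

theorem coe_normalForm (x : Coord) : (normalForm x).1 =
    !![((√(1 + ‖x.1‖ ^ 2) : ℝ) : ℍ) * (x.2 : ℍ), x.2 * star x.1;
      x.1, ((√(1 + ‖x.1‖ ^ 2) : ℝ) : ℍ)] := by
  change Sp11.paramMatrix (x.1, x.2, ((1 : Sp1) : ℍ)) = _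
  simp [Sp11.paramMatrix, ← Quaternion.coe_mul_eq_smul]

theorem cosetRep_apply (v : Sp1) (x : Coord) (i j : Fin 2) :
    (cosetRep v x).1 i j = v * (normalForm x).1 i j := by
  have h_star : star (v : ℍ) * v = 1 := by rw [Sp11.star_mul_self_eq]; simp
  change Sp11.paramMatrix (v * x.1, ((v * x.2 : Sp1) : ℍ), v) i j = _
  rw [coe_normalForm]
  fin_cases i <;> fin_cases j <;>
    simp [Sp11.paramMatrix, mul_assoc, h_star, ← Quaternion.coe_mul_eq_smul,
      Quaternion.coe_commutes]

theorem cosetCoord_cosetRep (v : Sp1) (x : Coord) : cosetCoord (cosetRep v x) = x := by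
  simp only [cosetCoord, cosetRep, Homeomorph.apply_symm_apply, inv_mul_cancel_left]
  simp [Metric.unitSphere.coe_inv, ne_zero_of_mem_unit_sphere]

theorem cosetRep_cosetCoord (A : Sp11) : cosetRep (Sp11.homeo A).2.2 (cosetCoord A) = A := by
  rw [cosetRep, cosetCoord, Homeomorph.symm_apply_eq]
  simp [Metric.unitSphere.coe_inv, ← mul_assoc, ne_zero_of_mem_unit_sphere]

theorem Sp11.contMDiff_inv : ContMDiff Sp11.model Sp11.model ∞ fun A : Sp11 => A⁻¹ := by
  rw [Sp11.contMDiff_iff]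
  intro i j
  have h_star (i j : Fin 2) : ContMDiff Sp11.model 𝓘(ℝ, ℍ) ∞ fun A : Sp11 => star (A.1 i j) :=
    contMDiff_star.comp (Sp11.contMDiff_entry i j)
  have h_neg (i j : Fin 2) : ContMDiff Sp11.model 𝓘(ℝ, ℍ) ∞ fun A : Sp11 => -star (A.1 i j) :=
    (h_star i j).neg
  simp only [Sp11.coe_inv, Matrix.mul_apply, Fin.sum_univ_two, Matrix.conjTranspose_apply]
  fin_cases i <;> fin_cases j <;> simp [J, h_star, h_neg]

theorem contMDiff_cosetCoord : ContMDiff Sp11.model coordModel ∞ cosetCoord := by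
  have h_fst := contMDiff_fst.comp Sp11.contMDiff_homeo
  have h_snd := contMDiff_snd.comp Sp11.contMDiff_homeo
  have h_inv := (contMDiff_snd.comp h_snd).inv
  exact ((contMDiff_coe_sphere.comp h_inv).mul h_fst).prodMk (h_inv.mul (contMDiff_fst.comp h_snd))

theorem contMDiff_cosetRep (v : Sp1) : ContMDiff coordModel Sp11.model ∞ (cosetRep v) := by
  rw [Sp11.contMDiff_iff_homeo]
  simp only [cosetRep, Homeomorph.apply_symm_apply]
  exact (contMDiff_const.mul contMDiff_fst).prodMk
    ((contMDiff_const.mul contMDiff_snd).prodMk contMDiff_const)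

theorem contMDiff_normalForm : ContMDiff coordModel Sp11.model ∞ normalForm :=
  (contMDiff_cosetRep 1).congr fun x => by simp [normalForm, cosetRep]

theorem mobius_cosetRep (v : Sp1) (x : Coord) :
    mobius (cosetRep v x) = mobius (normalForm x) :=
  mobius_eq_of_mul_left (norm_pos_iff.1 (by simp)) (cosetRep_apply v x)

theorem mobius_normalForm_cosetCoord (A : Sp11) :
    mobius (normalForm (cosetCoord A)) = mobius A := by
  rw [← mobius_cosetRep (Sp11.homeo A).2.2, cosetRep_cosetCoord]

/-- The homeomorphism `b ↦ b / √(1 + |b|²)` onto `𝔹`. -/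
def ballHomeo : ℍ ≃ₜ Ball := Homeomorph.unitBall

theorem coe_ballHomeo (b : ℍ) : (ballHomeo b : ℍ) = (√(1 + ‖b‖ ^ 2))⁻¹ • b :=
  Homeomorph.unitBall_apply_coe b

theorem sqrt_mul_ballHomeo (b : ℍ) : ((√(1 + ‖b‖ ^ 2) : ℝ) : ℍ) * ballHomeo b = b := by
  have hs : √(1 + ‖b‖ ^ 2) ≠ 0 := (Real.sqrt_pos.2 (by positivity)).ne'
  rw [coe_ballHomeo, Quaternion.coe_mul_eq_smul, smul_inv_smul₀ hs]

theorem mobius_normalForm_zero (x : Coord) : mobius (normalForm x) 0 = ballHomeo x.1 := by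
  refine Subtype.ext ?_
  rw [mobius_zero, coe_normalForm, coe_ballHomeo, ← Quaternion.coe_mul_eq_smul, Quaternion.coe_inv]
  rfl

end Coordinates

section Injectivity

theorem norm_lt_sqrt_one_add_norm_sq (b : ℍ) : ‖b‖ < √(1 + ‖b‖ ^ 2) :=
  Real.lt_sqrt_of_sq_lt (lt_one_add _)

theorem sqrt_sub_star_mul_ne_zero (b : ℍ) (q : Ball) :
    ((√(1 + ‖b‖ ^ 2) : ℝ) : ℍ) - star b * q ≠ 0 := by
  refine sub_ne_zero.2 fun h => ?_
  have h_lt : ‖star b * (q : ℍ)‖ < √(1 + ‖b‖ ^ 2) := by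
    rw [norm_mul, norm_star]
    exact (mul_le_of_le_one_right (norm_nonneg b) (norm_lt_one q).le).trans_lt
      (norm_lt_sqrt_one_add_norm_sq b)
  rw [← h, Quaternion.norm_coe, Real.norm_of_nonneg (Real.sqrt_nonneg _)] at h_lt
  exact h_lt.false

theorem mobius_normalForm_of_coe_eq (b : ℍ) (u : Sp1) {t : ℝ} {q : Ball} (hq : (q : ℍ) = t) :
    (t : ℍ) * (u * (((√(1 + ‖b‖ ^ 2) : ℝ) : ℍ) - star b * mobius (normalForm (b, u)) q)) =
      ((√(1 + ‖b‖ ^ 2) : ℝ) : ℍ) * mobius (normalForm (b, u)) q - b := by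
  have h := denom_mul_mobius (normalForm (b, u)) q fun i => hq ▸ Quaternion.coe_commute t _
  simp only [coe_normalForm, hq, Matrix.of_apply, Matrix.cons_val', Matrix.cons_val_zero,
    Matrix.cons_val_one, Matrix.cons_val_fin_one] at h
  rw [Quaternion.coe_commutes _ (u : ℍ)] at h
  generalize (mobius (normalForm (b, u)) q : ℍ) = F at h ⊢
  generalize ((√(1 + ‖b‖ ^ 2) : ℝ) : ℍ) = s at h ⊢
  calc (t : ℍ) * (u * (s - star b * F))
      = t * (u * s) + b - (t * (u * star b) + s) * F + (s * F - b) := by noncomm_ring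
    _ = s * F - b := by rw [h, sub_self, zero_add]

theorem mobius_normalForm_injective :
    Function.Injective fun x : Coord => mobius (normalForm x) := by
  rintro ⟨b, u⟩ ⟨b', u'⟩ (h : mobius (normalForm (b, u)) = mobius (normalForm (b', u')))
  obtain rfl : b = b' := ballHomeo.injective <| by
    simpa only [mobius_normalForm_zero] using congrFun h 0
  obtain ⟨q, hq⟩ : ∃ q : Ball, (q : ℍ) = (2⁻¹ : ℝ) :=
    ⟨⟨((2⁻¹ : ℝ) : ℍ), mem_ball_zero_iff.2 (by rw [Quaternion.norm_coe]; norm_num)⟩, rfl⟩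
  have ht : ((2⁻¹ : ℝ) : ℍ) ≠ 0 := by rw [← norm_ne_zero_iff, Quaternion.norm_coe]; norm_num
  have h_eq := mobius_normalForm_of_coe_eq b u hq
  rw [h, ← mobius_normalForm_of_coe_eq b u' hq] at h_eq
  exact Prod.ext rfl (Subtype.ext (mul_right_cancel₀ (sqrt_sub_star_mul_ne_zero b _)
    (mul_left_cancel₀ ht h_eq)))

end Injectivity

section Transitivity

theorem commute_ballHomeo_normalForm (b : ℍ) (i j : Fin 2) :
    Commute (ballHomeo b : ℍ) ((normalForm (-b, 1)).1 i j) := by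
  have h_self : Commute (ballHomeo b : ℍ) b := by
    rw [coe_ballHomeo]
    exact (Commute.refl b).smul_left _
  have h_star : Commute (ballHomeo b : ℍ) (star b) := by
    rw [coe_ballHomeo]
    exact Commute.smul_left (star_comm_self' b).symm _
  have h_real (t : ℝ) : Commute (ballHomeo b : ℍ) t := (Quaternion.coe_commute t _).symm
  rw [coe_normalForm]
  fin_cases i <;> fin_cases j <;> simp [h_self, h_star, h_real]

theorem mobius_normalForm_neg_ballHomeo (b : ℍ) :
    mobius (normalForm (-b, 1)) (ballHomeo b) = 0 := by
  have h := denom_mul_mobius (normalForm (-b, 1)) (ballHomeo b) fun i =>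
    commute_ballHomeo_normalForm b i 1
  have h_num : (ballHomeo b : ℍ) * (normalForm (-b, 1)).1 0 0 + (normalForm (-b, 1)).1 1 0 = 0 := by
    simp [coe_normalForm, ← Quaternion.coe_commutes, sqrt_mul_ballHomeo]
  rw [h_num] at h
  exact Subtype.ext ((mul_eq_zero.1 h).resolve_left (denom_ne_zero _ (norm_lt_one _)))

theorem exists_normalForm_eq_coe {b : ℍ} {u : Sp1} (hu : b = ‖b‖ • (u : ℍ)) (i : Fin 2) :
    ∃ t : ℝ, (normalForm (b, u)).1 i 1 = t := by
  have h_upper : (u : ℍ) * star b = (‖b‖ : ℝ) := by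
    rw [hu, norm_smul, norm_Sp1, norm_norm, mul_one, Quaternion.star_smul, mul_smul_comm,
      Sp11.self_mul_star_eq, norm_Sp1]
    simp [← Quaternion.coe_mul_eq_smul]
  rw [coe_normalForm]
  fin_cases i
  · exact ⟨‖b‖, h_upper⟩
  · exact ⟨√(1 + ‖b‖ ^ 2), rfl⟩

theorem exists_mobius_apply_eq (p q : Ball) : ∃ A : Sp11, mobius A p = q := by
  obtain ⟨b, rfl⟩ := ballHomeo.surjective p
  obtain ⟨c, rfl⟩ := ballHomeo.surjective q
  obtain ⟨u, hu⟩ := exists_eq_norm_smul c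
  refine ⟨normalForm (-b, 1) * normalForm (c, u), ?_⟩
  have h_zero := mobius_normalForm_neg_ballHomeo b
  have h_comm_right (i : Fin 2) :
      Commute (ballHomeo b : ℍ) ((normalForm (-b, 1) * normalForm (c, u)).1 i 1) := by
    obtain ⟨s, hs⟩ := exists_normalForm_eq_coe hu 0
    obtain ⟨t, ht⟩ := exists_normalForm_eq_coe hu 1
    simp only [Submonoid.coe_mul, Matrix.mul_apply, Fin.sum_univ_two, hs, ht]
    exact .add_right
      ((commute_ballHomeo_normalForm b i 0).mul_right (Quaternion.coe_commute s _).symm)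
      ((commute_ballHomeo_normalForm b i 1).mul_right (Quaternion.coe_commute t _).symm)
  rw [mobius_mul_apply _ _ _ (fun i => commute_ballHomeo_normalForm b i 1)
    (fun i => h_zero ▸ Commute.zero_left _) h_comm_right, h_zero, mobius_normalForm_zero]

end Transitivity

namespace MB

section Coordinates

/-- The coordinates of `𝓜(𝔹)`: the transformation with coordinates `(b, u)` is `𝓕_A` for the normal
form `A` of the coset with coordinates `(b, u)`. -/
def coordEquiv : Coord ≃ MB :=
  .ofBijective (fun x => ⟨mobius (normalForm x), _, rfl⟩)
    ⟨fun _ _ h => mobius_normalForm_injective (congrArg Subtype.val h), by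
      rintro ⟨_, A, rfl⟩
      exact ⟨cosetCoord A, Subtype.ext (mobius_normalForm_cosetCoord A)⟩⟩

theorem proj_eq_coordEquiv (A : Sp11) : proj A = coordEquiv (cosetCoord A⁻¹) :=
  Subtype.ext (mobius_normalForm_cosetCoord A⁻¹).symm

theorem proj_inv_cosetRep (v : Sp1) (x : Coord) : proj (cosetRep v x)⁻¹ = coordEquiv x := by
  rw [proj_eq_coordEquiv, inv_inv, cosetCoord_cosetRep]

theorem contMDiff_inv_cosetRep (v : Sp1) :
    ContMDiff coordModel Sp11.model ∞ fun x => (cosetRep v x)⁻¹ :=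
  Sp11.contMDiff_inv.comp (contMDiff_cosetRep v)

theorem contMDiff_cosetCoord_inv :
    ContMDiff Sp11.model coordModel ∞ fun A : Sp11 => cosetCoord A⁻¹ :=
  contMDiff_cosetCoord.comp Sp11.contMDiff_inv

end Coordinates

section Existence

/-- A linear change of the model space `ℍ × ℝ³` of the coordinates to `ℝ⁷`. -/
def modelEquiv : (ℍ × EuclideanSpace ℝ (Fin 3)) ≃L[ℝ] EuclideanSpace ℝ (Fin 7) :=
  .ofFinrankEq (by simp [Quaternion.finrank_eq_four])

theorem isQuotientManifold_of_diffeomorph [TopologicalSpace MB]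
    [ChartedSpace (EuclideanSpace ℝ (Fin 7)) MB] [IsManifold (𝓡 7) ∞ MB]
    (e : Coord ≃ₘ⟮coordModel, 𝓡 7⟯ MB) (he : ∀ x, e x = coordEquiv x) : IsQuotientManifold := by
  have h_proj : ContMDiff Sp11.model (𝓡 7) ∞ proj :=
    (e.contMDiff.comp contMDiff_cosetCoord_inv).congr fun A =>
      (proj_eq_coordEquiv A).trans (he _).symm
  have h_sec (v : Sp1) : ContMDiff (𝓡 7) Sp11.model ∞ fun F => (cosetRep v (e.symm F))⁻¹ :=
    (contMDiff_inv_cosetRep v).comp e.symm.contMDiff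
  have proj_sec (v : Sp1) (F : MB) : proj (cosetRep v (e.symm F))⁻¹ = F := by
    rw [proj_inv_cosetRep, ← he, e.apply_symm_apply]
  have sec_proj (A : Sp11) : (cosetRep (Sp11.homeo A⁻¹).2.2 (e.symm (proj A)))⁻¹ = A := by
    rw [proj_eq_coordEquiv, ← he, e.symm_apply_apply, cosetRep_cosetCoord, inv_inv]
  have h_emb := e.toHomeomorph.symm.isEmbedding
  exact
    { isManifold := ‹_›
      t2Space := h_emb.t2Space
      secondCountableTopology := h_emb.secondCountableTopology
      isQuotientMap := .of_inverse (h_sec 1).continuous h_proj.continuous (proj_sec 1)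
      contMDiff_proj := h_proj
      surjective_mfderiv := fun A => surjective_mfderiv_of_section
        (h_proj.mdifferentiable (by simp) A) ((h_sec _).mdifferentiable (by simp) _) (sec_proj A)
        (.of_forall (proj_sec _)) }

theorem exists_isQuotientManifold : ∃ (_ : TopologicalSpace MB)
    (_ : ChartedSpace (EuclideanSpace ℝ (Fin 7)) MB), IsQuotientManifold := by
  let _ : TopologicalSpace MB := .induced coordEquiv.symm inferInstance
  let e : Coord ≃ₜ MB := (coordEquiv.symm.toHomeomorphOfIsInducing ⟨rfl⟩).symm
  let L := prodModelDiffeomorph (n := ∞) modelEquiv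
  let _ := transportChartedSpace e L.toHomeomorph
  have := isManifold_transportChartedSpace e L
  exact ⟨_, _, isQuotientManifold_of_diffeomorph (transportDiffeomorph e L) fun _ => rfl⟩

end Existence

namespace IsQuotientManifold

section Uniqueness

variable [TopologicalSpace MB] [ChartedSpace (EuclideanSpace ℝ (Fin 7)) MB]

theorem contMDiff_coordEquiv (h : IsQuotientManifold) : ContMDiff coordModel (𝓡 7) ∞ coordEquiv :=
  (h.contMDiff_proj.comp (contMDiff_inv_cosetRep 1)).congr fun x => (proj_inv_cosetRep 1 x).symm

theorem continuous_coordEquiv_symm (h : IsQuotientManifold) : Continuous coordEquiv.symm :=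
  h.isQuotientMap.continuous_iff.2 <| contMDiff_cosetCoord_inv.continuous.congr fun A => by
    rw [Function.comp_apply, proj_eq_coordEquiv, coordEquiv.symm_apply_apply]

theorem surjective_mfderiv_coordEquiv (h : IsQuotientManifold) (x : Coord) :
    Function.Surjective (mfderiv coordModel (𝓡 7) coordEquiv x) := by
  obtain ⟨A, rfl⟩ : ∃ A : Sp11, cosetCoord A⁻¹ = x :=
    ⟨(cosetRep 1 x)⁻¹, by rw [inv_inv, cosetCoord_cosetRep]⟩
  have h_comp := mfderiv_comp (I := Sp11.model) (I' := coordModel) (I'' := 𝓡 7) A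
    (f := fun A : Sp11 => cosetCoord A⁻¹) (g := coordEquiv)
    (h.contMDiff_coordEquiv.mdifferentiable (by simp) _)
    (contMDiff_cosetCoord_inv.mdifferentiable (by simp) A)
  have h_surj := h.surjective_mfderiv A
  rw [funext proj_eq_coordEquiv] at h_surj
  exact .of_comp (h_comp ▸ h_surj)

/-- The coordinates of `𝓜(𝔹)`, as a diffeomorphism for an arbitrary manifold structure that makes
`A ↦ 𝓕_{A⁻¹}` a submersion and a quotient map. -/
def coordDiffeomorph (h : IsQuotientManifold) : Coord ≃ₘ⟮coordModel, 𝓡 7⟯ MB :=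
  diffeomorphOfSurjectiveMFDeriv (by simp [Quaternion.finrank_eq_four])
    { coordEquiv with
      continuous_toFun := h.contMDiff_coordEquiv.continuous
      continuous_invFun := h.continuous_coordEquiv_symm }
    h.contMDiff_coordEquiv (by simp) h.surjective_mfderiv_coordEquiv

theorem contMDiff_eval (h : IsQuotientManifold) :
    ContMDiff ((𝓡 7).prod 𝓘(ℝ, ℍ)) 𝓘(ℝ, ℍ) ∞ fun x : MB × Ball => x.1 x.2 := by
  have h_coord : ContMDiff ((𝓡 7).prod 𝓘(ℝ, ℍ)) Sp11.model ∞
      fun x : MB × Ball => normalForm (h.coordDiffeomorph.symm x.1) :=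
    contMDiff_normalForm.comp (h.coordDiffeomorph.symm.contMDiff.comp contMDiff_fst)
  refine (contMDiff_mobius.comp (h_coord.prodMk contMDiff_snd)).congr fun x => ?_
  exact congrArg (fun F : MB => F x.2) (h.coordDiffeomorph.apply_symm_apply x.1).symm

end Uniqueness

end IsQuotientManifold

section Isotropy

theorem coe_coordEquiv_zero (u : Sp1) : (coordEquiv (0, u)).1 = R u := by
  funext q
  refine Subtype.ext ((mobius_apply_of_eq (normalForm (0, u)) q (G := 1) ?_).trans ?_) <;>
    simp [coe_normalForm, R]

theorem coordEquiv_mem_isotropy {x : Coord} : coordEquiv x ∈ isotropy ↔ x.1 = 0 := by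
  have h_zero : ballHomeo 0 = 0 := Subtype.ext (by simp [coe_ballHomeo])
  change mobius (normalForm x) 0 = 0 ↔ _
  rw [mobius_normalForm_zero, ← h_zero, ballHomeo.injective.eq_iff]

/-- The bijection `u ↦ R_u` onto the isotropy at `0`. -/
def isotropyEquiv : Sp1 ≃ isotropy where
  toFun u := ⟨coordEquiv (0, u), coordEquiv_mem_isotropy.2 rfl⟩
  invFun F := (coordEquiv.symm F.1).2
  left_inv u := by simp
  right_inv := by
    rintro ⟨F, hF⟩
    obtain ⟨⟨b, u⟩, rfl⟩ := coordEquiv.surjective F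
    obtain rfl : b = 0 := coordEquiv_mem_isotropy.1 hF
    simp

theorem isotropyEquiv_apply (u : Sp1) (q : Ball) : (isotropyEquiv u).1 q = R u q :=
  congrFun (coe_coordEquiv_zero u) q

theorem setOf_isotropy_eq_range_R : {f : Ball → Ball | f ∈ mobiusSet ∧ f 0 = 0} = Set.range R := by
  ext f
  constructor
  · rintro ⟨hf, h0⟩
    obtain ⟨u, hu⟩ := isotropyEquiv.surjective ⟨⟨f, hf⟩, h0⟩
    exact ⟨u, funext fun q => by rw [← isotropyEquiv_apply, hu]⟩
  · rintro ⟨u, rfl⟩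
    rw [← coe_coordEquiv_zero]
    exact ⟨(coordEquiv (0, u)).2, (isotropyEquiv u).2⟩

-- `R_u ∘ R_v = R_{v u}`, so composition is the product of `Sp(1)` read through `u ↦ R_{u⁻¹}`.
instance : Group isotropy := ((Equiv.inv Sp1).trans isotropyEquiv).symm.group

/-- The isomorphism `u ↦ R_{u⁻¹}` onto the isotropy at `0`. -/
def isotropyMulEquiv : Sp1 ≃* isotropy :=
  ((Equiv.inv Sp1).trans isotropyEquiv).symm.mulEquiv.symm

theorem isotropyMulEquiv_apply (u : Sp1) (q : Ball) : (isotropyMulEquiv u).1 q = R u⁻¹ q :=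
  isotropyEquiv_apply u⁻¹ q

theorem isotropy_mul_apply (F G : isotropy) (q : Ball) : (F * G).1 q = F.1 (G.1 q) := by
  obtain ⟨u, rfl⟩ := isotropyMulEquiv.surjective F
  obtain ⟨v, rfl⟩ := isotropyMulEquiv.surjective G
  rw [← map_mul]
  simp only [isotropyMulEquiv_apply]
  exact Subtype.ext (by simp [R, mul_assoc])

end Isotropy

namespace IsQuotientManifold

section IsotropyManifold

variable [TopologicalSpace MB] [ChartedSpace (EuclideanSpace ℝ (Fin 7)) MB]

/-- The bijection `u ↦ R_u`, as a homeomorphism onto the isotropy at `0`. -/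
def isotropyHomeo (h : IsQuotientManifold) : Sp1 ≃ₜ isotropy where
  toEquiv := isotropyEquiv
  continuous_toFun :=
    (h.coordDiffeomorph.continuous.comp (continuous_const.prodMk continuous_id)).subtype_mk _
  continuous_invFun :=
    continuous_snd.comp (h.coordDiffeomorph.symm.continuous.comp continuous_subtype_val)

theorem isCompact_isotropy (h : IsQuotientManifold) : IsCompact isotropy :=
  have := h.isotropyHomeo.compactSpace
  isCompact_iff_compactSpace.2 this

/-- The manifold structure of the isotropy at `0` for which `u ↦ R_u` is a diffeomorphism. -/
@[reducible]
def isotropyChartedSpace (h : IsQuotientManifold) :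
    ChartedSpace (EuclideanSpace ℝ (Fin 3)) isotropy :=
  transportChartedSpace h.isotropyHomeo
    (Diffeomorph.refl (𝓡 3) (EuclideanSpace ℝ (Fin 3)) ∞).toHomeomorph

theorem isManifold_isotropy (h : IsQuotientManifold) :
    letI := h.isotropyChartedSpace
    IsManifold (𝓡 3) ∞ isotropy :=
  isManifold_transportChartedSpace h.isotropyHomeo (Diffeomorph.refl _ _ _)

/-- The bijection `u ↦ R_u`, as a diffeomorphism onto the isotropy at `0`. -/
def isotropyDiffeomorph (h : IsQuotientManifold) :
    letI := h.isotropyChartedSpace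
    Sp1 ≃ₘ⟮𝓡 3, 𝓡 3⟯ isotropy :=
  transportDiffeomorph h.isotropyHomeo (Diffeomorph.refl _ _ _)

theorem isSmoothEmbedding_isotropy (h : IsQuotientManifold) :
    letI := h.isotropyChartedSpace
    Manifold.IsSmoothEmbedding (𝓡 3) (𝓡 7) ∞ (Subtype.val : isotropy → MB) := by
  let _ := h.isotropyChartedSpace
  have := h.isManifold_isotropy
  have := h.isManifold
  have h_slice := isImmersionOfComplement_of_slice modelEquiv h.coordDiffeomorph
    h.isotropyDiffeomorph (ι := Subtype.val) fun _ => rfl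
  exact ⟨h_slice.isImmersion, Topology.IsEmbedding.subtypeVal⟩

theorem contMDiff_isotropyMulEquiv (h : IsQuotientManifold) :
    letI := h.isotropyChartedSpace
    ContMDiff (𝓡 3) (𝓡 3) ∞ isotropyMulEquiv :=
  letI := h.isotropyChartedSpace
  (h.isotropyDiffeomorph.contMDiff.comp (contMDiff_inv (𝓡 3) ∞)).congr fun _ => rfl

theorem contMDiff_isotropyMulEquiv_symm (h : IsQuotientManifold) :
    letI := h.isotropyChartedSpace
    ContMDiff (𝓡 3) (𝓡 3) ∞ isotropyMulEquiv.symm :=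
  letI := h.isotropyChartedSpace
  h.isotropyDiffeomorph.symm.contMDiff.inv

theorem lieGroup_isotropy (h : IsQuotientManifold) :
    letI := h.isotropyChartedSpace
    LieGroup (𝓡 3) ∞ isotropy :=
  letI := h.isotropyChartedSpace
  have := h.isManifold_isotropy
  lieGroup_of_mulEquiv isotropyMulEquiv h.contMDiff_isotropyMulEquiv
    h.contMDiff_isotropyMulEquiv_symm

end IsotropyManifold

end IsQuotientManifold

end MB

end RegMobius

end

theorem mainTheorem3 :
    -- `𝓜(𝔹)` has a manifold structure coming from `Sp(1,1)/Sp(1)I₂`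
    (∃ (_ : TopologicalSpace RegMobius.MB)
      (_ : ChartedSpace (EuclideanSpace ℝ (Fin 7)) RegMobius.MB),
      RegMobius.MB.IsQuotientManifold) ∧
    ∀ [TopologicalSpace RegMobius.MB] [ChartedSpace (EuclideanSpace ℝ (Fin 7)) RegMobius.MB],
      RegMobius.MB.IsQuotientManifold →
      -- the evaluation map is smooth
      ContMDiff ((𝓡 7).prod 𝓘(ℝ, ℍ)) 𝓘(ℝ, ℍ) ∞
        (fun x : RegMobius.MB × RegMobius.Ball => x.1 x.2) ∧
      -- transitivity
      (∀ p q : RegMobius.Ball, ∃ F : RegMobius.MB, F p = q) ∧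
      -- the isotropy at `0`
      {f : RegMobius.Ball → RegMobius.Ball | f ∈ RegMobius.mobiusSet ∧ f 0 = 0} =
        Set.range RegMobius.R ∧
      -- the isotropy at `0` is a compact embedded submanifold, and a Lie group under composition,
      -- isomorphic to `Sp(1)` by `u ↦ R_{u⁻¹}`
      IsCompact RegMobius.MB.isotropy ∧
      ∃ (_ : ChartedSpace (EuclideanSpace ℝ (Fin 3)) RegMobius.MB.isotropy)
        (_ : Group RegMobius.MB.isotropy),
        IsManifold (𝓡 3) ∞ RegMobius.MB.isotropy ∧
        Manifold.IsSmoothEmbedding (𝓡 3) (𝓡 7) ∞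
          (Subtype.val : RegMobius.MB.isotropy → RegMobius.MB) ∧
        (∀ (F G : RegMobius.MB.isotropy) (q : RegMobius.Ball), (F * G).1 q = F.1 (G.1 q)) ∧
        LieGroup (𝓡 3) ∞ RegMobius.MB.isotropy ∧
        ∃ ρ : RegMobius.Sp1 ≃* RegMobius.MB.isotropy,
          (∀ (u : RegMobius.Sp1) (q : RegMobius.Ball), (ρ u).1 q = RegMobius.R u⁻¹ q) ∧
          ContMDiff (𝓡 3) (𝓡 3) ∞ ρ ∧ ContMDiff (𝓡 3) (𝓡 3) ∞ ρ.symm := by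
  refine ⟨RegMobius.MB.exists_isQuotientManifold, fun h => ?_⟩
  have transitivity (p q : RegMobius.Ball) : ∃ F : RegMobius.MB, F p = q :=
    let ⟨A, hA⟩ := RegMobius.exists_mobius_apply_eq p q
    ⟨⟨RegMobius.mobius A, A, rfl⟩, hA⟩
  exact ⟨h.contMDiff_eval, transitivity, RegMobius.MB.setOf_isotropy_eq_range_R,
    h.isCompact_isotropy, h.isotropyChartedSpace, inferInstance, h.isManifold_isotropy,
    h.isSmoothEmbedding_isotropy, RegMobius.MB.isotropy_mul_apply, h.lieGroup_isotropy,
    RegMobius.MB.isotropyMulEquiv, RegMobius.MB.isotropyMulEquiv_apply,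
    h.contMDiff_isotropyMulEquiv, h.contMDiff_isotropyMulEquiv_symm⟩
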